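/- **Setting.** Consider a network of $m$ followers and one leader with nonnegative weights $w_{ij}$ (link from follower $j$ to follower $i$) and $w_{i0}$ (link from the leader to follower $i$), balanced so that $\sum_j w_{ij}+w_{i0}=1$ for every $i$, and such that every follower is reachable from the leader by a directed path. Put $\mathbb A_0=\mathrm{diag}(w_{i0})$ and $\mathbb L=\mathbb L_m+\mathbb A_0$, with $\mathbb L_m$ the Laplacian of the follower subgraph. For follower positions $\bar x(t)\in\mathbb R^m$ and leader position $x_0(t)\in\mathbb R$, $\bar x_0=\mathbf 1_m x_0$, the synchronization error is $\bar e=-\mathbb L\bar x+\mathbb A_0\bar x_0$. Let $J,B,\Phi,\Theta$ be real diagonal matrices with entries $J_i>0$, $b_i\in\mathbb R$, $\phi_i>0$, $\theta_i>0$, let $0<p_i<q_i$, and let $K^\ast=\mathrm{diag}(k_i^\ast)$ be real. Put $$\mathbf C_w=\Phi\,(sI+\mathrm{diag}(p_i))(sI+\mathrm{diag}(q_i))^{-1},\qquad \mathbf W_w^-=\mathbf C_w\,[Js^2+Bs+K^\ast\mathbf C_w]^{-1},\qquad \mathbf W_w=\mathbf W_w^-(sI+\Theta).$$ A real-rational square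 matrix $\mathbf W$ is positive real if it is analytic in $\Re s>0$ and $\mathbf W(s)+\mathbf W(s)^*\succeq0$ there; it is strictly positive real (SPR) if $\mathbf W(s-\epsilon)$ is positive real for some $\epsilon>0$. **Adaptive loop** (only positions available). The leader position $x_0$ is twice differentiable on $[0,\infty)$. The signal $\Omega_{x_0}=\mathbf C_w^{-1}\bar x_0$ is a solution of $\phi_i(\dot\Omega_{x_0,i}+p_i\Omega_{x_0,i})=\dot x_0+q_ix_0$ for every $i$; the regressor is $\eta_w=[\bar e^\top,\ddot\Omega_{x_0}^\top,\dot\Omega_{x_0}^\top]^\top$, and it is pre-filtered blockwise by $(sI+\Theta)^{-1}$: $\dot{\bar\eta}_w=-(I_3\otimes\Theta)\bar\eta_w+\eta_w$. With the true parameter $\Xi_w=[K^\ast,J,B]$, the estimate $\hat\Xi_w$ and $\tilde\Xi_w=\hat\Xi_w-\Xi_w\in\mathbb R^{m\times 3m}$, the error model is $\bar e=\mathbf W_w\tilde\Xi_w\bar\eta_w$, that is $$\dot{\bar e}_x=A\bar e_x+\mathcal B\,\tilde\Xi_w\bar\eta_w,\qquad \bar e=c^\top\bar e_x,$$ where $(A,\mathcal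 B,c)$ is any stabilizable and detectable (for example, any minimal) state-space realization of $\mathbf W_w$. The adaptive law is $\dot{\tilde\Xi}_w=-\Gamma_\xi\,\bar e\,\bar\eta_w^\top$ with $\Gamma_\xi$ symmetric positive definite. **Claim.** 1. For every $K^\ast$, $\mathbf W_w$ is diagonal and each of its diagonal entries has relative degree $1$. 2. $\mathbf W_w$ is rendered SPR by the choice of $\Theta$ and $K^\ast$: if $\theta_i<q_i-p_i+b_i/J_i$ for all $i$, there is $\kappa$ such that $\mathbf W_w$ is SPR for every $K^\ast$ with all $k_i^\ast\ge\kappa$. 3. Whenever $\mathbf W_w$ is SPR, every solution of the adaptive loop on $[0,\infty)$ has $\bar e_x$, $\bar e$ and $\tilde\Xi_w$ bounded and $\bar e_x\in\mathcal L_2$. If moreover $\dot x_0$ and $\ddot x_0$ are bounded, then $\bar e_x(t)\to0$, $\bar e(t)\to\mathbf 0_m$, and $x_i(t)-x_0(t)\to0$ for every $i$. -/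

import Mathlib

open Matrix Filter Topology
open scoped ComplexOrder

noncomputable section

/-! ## Real-rational transfer matrices -/

/-- A square real-rational transfer matrix (entries in `ℝ(s)`). -/
abbrev TransferMatrix (m : ℕ) : Type := Matrix (Fin m) (Fin m) (RatFunc ℝ)

/-- The value of a real-rational transfer matrix at a complex point. Entries are evaluated in lowest
terms. At a pole the value is `0`, and there the evaluation map is not continuous. -/
def TransferMatrix.evalAt {m : ℕ} (W : TransferMatrix m) (s : ℂ) : Matrix (Fin m) (Fin m) ℂ :=
  W.map (RatFunc.eval (algebraMap ℝ ℂ) s)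

/-- Positive realness of a matrix function: analytic in `Re s > 0`, and `F(s) + F(s)ᴴ ⪰ 0` there. -/
def IsPositiveReal {m : ℕ} (F : ℂ → Matrix (Fin m) (Fin m) ℂ) : Prop :=
  (∀ i j, AnalyticOnNhd ℂ (fun s => F s i j) {s : ℂ | 0 < s.re}) ∧
    ∀ s : ℂ, 0 < s.re → (F s + (F s)ᴴ).PosSemidef

/-- Strict positive realness: `W(s - ε)` is positive real for some `ε > 0`. -/
def TransferMatrix.IsSPR {m : ℕ} (W : TransferMatrix m) : Prop :=
  ∃ ε : ℝ, 0 < ε ∧ IsPositiveReal (fun s : ℂ => W.evalAt (s - (ε : ℂ)))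

/-- Relative degree of a scalar rational function: degree of the denominator minus degree of the
numerator. -/
def relativeDegree (f : RatFunc ℝ) : ℤ := -f.intDegree

/-- A constant diagonal matrix, seen as a transfer matrix. -/
def constDiag {m : ℕ} (v : Fin m → ℝ) : TransferMatrix m :=
  Matrix.diagonal fun i => RatFunc.C (v i)

/-- `s I_m`. -/
def sId (m : ℕ) : TransferMatrix m := Matrix.diagonal fun _ => RatFunc.X

/-! ## The leader-follower network -/

/-- A weighted directed communication network with `m` followers and one leader.
`adj i j` is the weight of the link from follower `j` to follower `i`, and `lead i` the weight of the
link from the leader to follower `i`. The weights are balanced and every follower can be reached from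
the leader by a directed path. -/
structure LeaderNetwork (m : ℕ) where
  adj : Matrix (Fin m) (Fin m) ℝ
  lead : Fin m → ℝ
  adj_nonneg : ∀ i j, 0 ≤ adj i j
  lead_nonneg : ∀ i, 0 ≤ lead i
  balanced : ∀ i, (∑ j, adj i j) + lead i = 1
  reachable : ∀ i, ∃ k, 0 < lead k ∧ Relation.ReflTransGen (fun j l => 0 < adj l j) k i

namespace LeaderNetwork

variable {m : ℕ} (G : LeaderNetwork m)

/-- The leader-weight matrix `𝔸₀`. -/
def leadMatrix : Matrix (Fin m) (Fin m) ℝ := Matrix.diagonal G.lead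

/-- `𝕃 = 𝕃_m + 𝔸₀`, with `𝕃_m = 𝔻_m - 𝔸_m` the Laplacian of the follower subgraph. -/
def lap : Matrix (Fin m) (Fin m) ℝ :=
  (Matrix.diagonal (fun i => ∑ j, G.adj i j) - G.adj) + G.leadMatrix

/-- The synchronization error `ē = -𝕃 x̄ + 𝔸₀ (1 ⊗ x₀)`. -/
def syncError (x : Fin m → ℝ) (x0 : ℝ) : Fin m → ℝ :=
  -(G.lap *ᵥ x) + G.leadMatrix *ᵥ (fun _ => x0)

end LeaderNetwork

/-! ## Followers, lead compensator, shaping filter -/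

/-- Followers `J_i ẍ_i + b_i ẋ_i = u_i` with `J_i > 0` and `b_i` of any sign, phase-lead compensators
`φ_i (s + p_i) / (s + q_i)` with `φ_i > 0` and `0 < p_i < q_i`, and shaping factors `s + θ_i` with
`θ_i > 0`. -/
structure ShapedDesign (m : ℕ) where
  J : Fin m → ℝ
  b : Fin m → ℝ
  φ : Fin m → ℝ
  p : Fin m → ℝ
  q : Fin m → ℝ
  θ : Fin m → ℝ
  J_pos : ∀ i, 0 < J i
  φ_pos : ∀ i, 0 < φ i
  p_pos : ∀ i, 0 < p i
  p_lt_q : ∀ i, p i < q i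
  θ_pos : ∀ i, 0 < θ i

namespace ShapedDesign

variable {m : ℕ} (S : ShapedDesign m)

/-- `C_w = Φ N D⁻¹`, with `N = s I + diag p` and `D = s I + diag q`. -/
def Cw : TransferMatrix m :=
  constDiag S.φ * (sId m + constDiag S.p) * (sId m + constDiag S.q)⁻¹

/-- `Π_w⁻ = J s² + B s + K* C_w`. -/
def PiMinus (k : Fin m → ℝ) : TransferMatrix m :=
  constDiag S.J * sId m ^ 2 + constDiag S.b * sId m + constDiag k * S.Cw

/-- The unshaped closed-loop transfer matrix `W_w⁻ = C_w (Π_w⁻)⁻¹`. -/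
def WMinus (k : Fin m → ℝ) : TransferMatrix m := S.Cw * (S.PiMinus k)⁻¹

/-- The composite transfer matrix `W_w = W_w⁻ (s I + Θ)`. -/
def Ww (k : Fin m → ℝ) : TransferMatrix m := S.WMinus k * (sId m + constDiag S.θ)

/-- The true parameter matrix `Ξ_w = [K*, J, B]`. -/
def trueParam (k : Fin m → ℝ) : Matrix (Fin m) (Fin 3 × Fin m) ℝ :=
  Matrix.of fun i l =>
    (![Matrix.diagonal k, Matrix.diagonal S.J, Matrix.diagonal S.b] l.1 :
      Matrix (Fin m) (Fin m) ℝ) i l.2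

end ShapedDesign

/-! ## State-space realizations -/

/-- A state-space system `ẋ = A x + B v`, `y = cᵀ x` with `m` inputs and `m` outputs. -/
structure StateSpace (n m : ℕ) where
  A : Matrix (Fin n) (Fin n) ℝ
  B : Matrix (Fin n) (Fin m) ℝ
  c : Matrix (Fin n) (Fin m) ℝ

namespace StateSpace

variable {n m : ℕ} (R : StateSpace n m)

/-- The transfer matrix `cᵀ (s I - A)⁻¹ B`. -/
def transfer : TransferMatrix m :=
  (R.cᵀ.map RatFunc.C) * (sId n - R.A.map RatFunc.C)⁻¹ * (R.B.map RatFunc.C)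

/-- No uncontrollable mode in the closed right half-plane (Hautus test). -/
def IsStabilizable : Prop :=
  ∀ (z : ℂ) (v : Fin n → ℂ), 0 ≤ z.re → v ᵥ* R.A.map Complex.ofReal = z • v →
    v ᵥ* R.B.map Complex.ofReal = 0 → v = 0

/-- No unobservable mode in the closed right half-plane (Hautus test). -/
def IsDetectable : Prop :=
  ∀ (z : ℂ) (v : Fin n → ℂ), 0 ≤ z.re → R.A.map Complex.ofReal *ᵥ v = z • v →
    R.cᵀ.map Complex.ofReal *ᵥ v = 0 → v = 0

/-- `R` realizes `W` without hidden unstable modes. Every minimal realization is of this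
kind. -/
def Realizes (W : TransferMatrix m) : Prop :=
  R.transfer = W ∧ R.IsStabilizable ∧ R.IsDetectable

end StateSpace

/-! ## The adaptive error system -/

/-- `f` has derivative `g` at every time of `[0, ∞)` (one-sided at `0`). -/
def HasTimeDeriv (f g : ℝ → ℝ) : Prop :=
  ∀ t : ℝ, 0 ≤ t → HasDerivWithinAt f (g t) (Set.Ici 0) t

/-- The signals of the position-only adaptive loop with shaped regressor, on `[0, ∞)`. -/
structure LoopSignals (n m : ℕ) where
  /-- leader position, velocity and acceleration -/
  x0 : ℝ → ℝ
  v0 : ℝ → ℝ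
  a0 : ℝ → ℝ
  /-- follower positions -/
  x : ℝ → Fin m → ℝ
  /-- the filtered leader signal `Ω_{x₀}` and its first two derivatives -/
  Om : ℝ → Fin m → ℝ
  dOm : ℝ → Fin m → ℝ
  ddOm : ℝ → Fin m → ℝ
  /-- the pre-filtered regressor -/
  etaBar : ℝ → Fin 3 × Fin m → ℝ
  /-- the parameter estimate `[K̂, Ĵ, B̂]` -/
  XiHat : ℝ → Matrix (Fin m) (Fin 3 × Fin m) ℝ
  /-- the internal error state -/
  ex : ℝ → Fin n → ℝ

namespace LoopSignals

variable {n m : ℕ} (σ : LoopSignals n m)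

/-- `ē(t)`. -/
def err (G : LeaderNetwork m) (t : ℝ) : Fin m → ℝ := G.syncError (σ.x t) (σ.x0 t)

/-- The regressor `η_w = [ē; Ω̈_{x₀}; Ω̇_{x₀}]`. -/
def eta (G : LeaderNetwork m) (t : ℝ) : Fin 3 × Fin m → ℝ :=
  fun l => (![σ.err G t, σ.ddOm t, σ.dOm t] l.1 : Fin m → ℝ) l.2

/-- The parameter error `Ξ̃_w = Ξ̂_w - Ξ_w`. -/
def XiTilde (S : ShapedDesign m) (k : Fin m → ℝ) (t : ℝ) : Matrix (Fin m) (Fin 3 × Fin m) ℝ :=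
  σ.XiHat t - S.trueParam k

/-- The equations of the adaptive loop. -/
structure Solves (G : LeaderNetwork m) (S : ShapedDesign m) (k : Fin m → ℝ)
    (R : StateSpace n m) (Γ : Matrix (Fin m) (Fin m) ℝ) : Prop where
  /-- `v0` and `a0` are the leader's velocity and acceleration -/
  leader_vel : HasTimeDeriv σ.x0 σ.v0
  leader_acc : HasTimeDeriv σ.v0 σ.a0
  /-- `dOm` and `ddOm` are the derivatives of `Om` -/
  Om_deriv : ∀ i, HasTimeDeriv (fun t => σ.Om t i) (fun t => σ.dOm t i)
  dOm_deriv : ∀ i, HasTimeDeriv (fun t => σ.dOm t i) (fun t => σ.ddOm t i)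
  /-- `Ω_{x₀} = C_w⁻¹ x̄₀`, that is `Φ N Ω_{x₀} = D x̄₀` -/
  Om_filter : ∀ t, 0 ≤ t → ∀ i,
    S.φ i * (σ.dOm t i + S.p i * σ.Om t i) = σ.v0 t + S.q i * σ.x0 t
  /-- `η̄_w = (s I + Θ)⁻¹ η_w`, blockwise -/
  prefilter : ∀ l : Fin 3 × Fin m,
    HasTimeDeriv (fun t => σ.etaBar t l) (fun t => σ.eta G t l - S.θ l.2 * σ.etaBar t l)
  /-- error model `ē = W_w Ξ̃_w η̄_w` in state space: `ė_x = A e_x + B Ξ̃_w η̄_w`, `ē = cᵀ e_x` -/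
  state : ∀ j, HasTimeDeriv (fun t => σ.ex t j)
    (fun t => (R.A *ᵥ σ.ex t + R.B *ᵥ (σ.XiTilde S k t *ᵥ σ.etaBar t)) j)
  output : ∀ t, 0 ≤ t → σ.err G t = R.cᵀ *ᵥ σ.ex t
  /-- gradient law `dΞ̃_w/dt = -Γ ē η̄_wᵀ` -/
  gradient : ∀ i l, HasTimeDeriv (fun t => σ.XiTilde S k t i l)
    (fun t => -(Γ * Matrix.vecMulVec (σ.err G t) (σ.etaBar t)) i l)

end LoopSignals

end

/-! Everything decouples: channel `i` of `W_w` is a quotient of the polynomials `num` and `den`, of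
degrees 2 and 3, which gives claim 1.

For claim 2 the reciprocal channel is expanded as `φ⁻¹ (J s + c₀ + (kφ + α)/(s + θ) + γ/((s + p)(s +
θ)))`. The condition on `θ` says exactly that `c₀ > 0`, and a large gain lets the third term absorb
the last one by completing a square (`re_den_div_num_pos`).

Claim 3 is a Lyapunov argument. It needs a matrix `P > 0` with `P B = c` and `x ⬝ P A x < 0` for `x
≠ 0`; then the energy `x ⬝ P x + tr (Ξ̃ᵀ Γ⁻¹ Ξ̃)` has derivative `2 x ⬝ P A x`, since the gradient
law cancels the cross term. Boundedness and square integrability follow. With bounded leader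
velocity and acceleration the regressor is bounded, hence so is the derivative of the state, and a
Barbalat argument gives convergence. Invertibility of `𝕃`, a maximum principle along paths from the
leader, turns `ē → 0` into `x_i - x₀ → 0`.

The matrix `P` comes from a Kalman-Yakubovich-Popov lemma (`exists_kyp_matrix`) proved by convex
separation. The frequency inequality says that a compact convex image of the trace-one positive
semidefinite matrices misses a closed convex set; a separating functional is the desired form.
Disjointness rests on splitting such a matrix into rank-one pieces, each belonging to a single
frequency (`re_trace_nonneg_of_frequency`). Strictness of SPR supplies the inequality at infinite
frequency, `cᵀ A B < 0`. Stabilizability and detectability make `A` Hurwitz, and this makes `P`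
positive definite. -/

noncomputable section

/-! ### Rational functions: degree and evaluation of a quotient -/

section RationalFunctions

open Polynomial

theorem diagonal_inv_of_ne_zero {K : Type*} [Field K] {m : ℕ} {v : Fin m → K} (hv : ∀ i, v i ≠ 0) :
    (diagonal v)⁻¹ = diagonal fun i => (v i)⁻¹ := by
  refine inv_eq_right_inv ?_
  rw [diagonal_mul_diagonal, ← diagonal_one]
  congr 1
  ext i
  exact mul_inv_cancel₀ (hv i)

theorem relativeDegree_div {p q : ℝ[X]} (hp : p ≠ 0) (hq : q ≠ 0) :
    relativeDegree (algebraMap ℝ[X] (RatFunc ℝ) p / algebraMap ℝ[X] (RatFunc ℝ) q)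
      = q.natDegree - p.natDegree := by
  rw [relativeDegree, div_eq_mul_inv, RatFunc.intDegree_mul (RatFunc.algebraMap_ne_zero hp)
    (inv_ne_zero (RatFunc.algebraMap_ne_zero hq)), RatFunc.intDegree_inv,
    RatFunc.intDegree_polynomial, RatFunc.intDegree_polynomial]
  ring

/-- The reduced denominator divides `q`, so it does not vanish at `s` either, and the
cross-multiplied polynomial identity can be evaluated. -/
theorem eval_div_mul_aeval {p q : ℝ[X]} (hq : q ≠ 0) (s : ℂ) (hs : aeval s q ≠ 0) :
    RatFunc.eval (algebraMap ℝ ℂ) s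
      (algebraMap ℝ[X] (RatFunc ℝ) p / algebraMap ℝ[X] (RatFunc ℝ) q) = aeval s p / aeval s q := by
  set r := algebraMap ℝ[X] (RatFunc ℝ) p / algebraMap ℝ[X] (RatFunc ℝ) q with hr
  have h1 : r.num * q = p * r.denom := (RatFunc.num_mul_eq_mul_denom_iff hq).2 hr
  have h2 : aeval s r.denom ≠ 0 := by
    intro h0
    obtain ⟨c, hc⟩ : r.denom ∣ q := RatFunc.denom_div_dvd p q
    apply hs
    rw [hc, map_mul, h0, zero_mul]
  have h3 := congrArg (aeval s) h1
  rw [map_mul, map_mul] at h3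
  rw [RatFunc.eval, ← aeval_def, ← aeval_def, div_eq_div_iff h2 hs, h3]

end RationalFunctions

/-! ### The scalar channels of `W_w`: relative degree and strict positive realness -/

namespace ShapedDesign

open Polynomial

variable {m : ℕ} (S : ShapedDesign m)

/-- Numerator of the `i`-th channel of `W_w`. -/
def num (i : Fin m) : ℝ[X] := C (S.φ i) * (X + C (S.p i)) * (X + C (S.θ i))

/-- Denominator of the `i`-th channel of `W_w`. -/
def den (k : Fin m → ℝ) (i : Fin m) : ℝ[X] :=
  (C (S.J i) * X ^ 2 + C (S.b i) * X) * (X + C (S.q i)) + C (k i * S.φ i) * (X + C (S.p i))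

theorem natDegree_num (i : Fin m) : (S.num i).natDegree = 2 := by
  have := (S.φ_pos i).ne'
  unfold num
  compute_degree!

theorem natDegree_den (k : Fin m → ℝ) (i : Fin m) : (S.den k i).natDegree = 3 := by
  have := (S.J_pos i).ne'
  unfold den
  compute_degree!

theorem num_ne_zero (i : Fin m) : S.num i ≠ 0 := by
  intro h; have := S.natDegree_num i; rw [h] at this; simp at this

theorem den_ne_zero (k : Fin m → ℝ) (i : Fin m) : S.den k i ≠ 0 := by
  intro h; have := S.natDegree_den k i; rw [h] at this; simp at this

theorem Ww_eq_diagonal (k : Fin m → ℝ) :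
    S.Ww k = diagonal fun i => algebraMap ℝ[X] (RatFunc ℝ) (S.num i)
      / algebraMap ℝ[X] (RatFunc ℝ) (S.den k i) := by
  have hq : ∀ i, (RatFunc.X + RatFunc.C (S.q i) : RatFunc ℝ) ≠ 0 := by
    intro i
    have h := RatFunc.algebraMap_ne_zero (K := ℝ) (X_add_C_ne_zero (S.q i))
    simpa using h
  have hden : ∀ i, algebraMap ℝ[X] (RatFunc ℝ) (S.den k i) ≠ 0 := fun i =>
    RatFunc.algebraMap_ne_zero (S.den_ne_zero k i)
  have hCw : S.Cw = diagonal fun i => RatFunc.C (S.φ i) * (RatFunc.X + RatFunc.C (S.p i))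
      * (RatFunc.X + RatFunc.C (S.q i))⁻¹ := by
    rw [Cw, constDiag, constDiag, constDiag, sId, diagonal_add, diagonal_add,
      diagonal_inv_of_ne_zero hq, diagonal_mul_diagonal, diagonal_mul_diagonal]
  have hPi : S.PiMinus k = diagonal fun i => algebraMap ℝ[X] (RatFunc ℝ) (S.den k i)
      * (RatFunc.X + RatFunc.C (S.q i))⁻¹ := by
    rw [PiMinus, hCw, constDiag, constDiag, constDiag, sId, diagonal_pow, diagonal_mul_diagonal,
      diagonal_mul_diagonal, diagonal_mul_diagonal, diagonal_add, diagonal_add]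
    congr 1
    ext i
    rw [eq_mul_inv_iff_mul_eq₀ (hq i), den]
    simp only [map_add, map_mul, map_pow, RatFunc.algebraMap_X, RatFunc.algebraMap_C, Pi.pow_apply]
    have := mul_inv_cancel₀ (hq i)
    linear_combination (RatFunc.C (k i) * (RatFunc.C (S.φ i) * (RatFunc.X + RatFunc.C (S.p i)))) * this
  rw [Ww, WMinus, hCw, hPi, diagonal_inv_of_ne_zero
    (fun i => mul_ne_zero (hden i) (inv_ne_zero (hq i))), sId, constDiag, diagonal_add,
    diagonal_mul_diagonal, diagonal_mul_diagonal]
  congr 1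
  ext i
  rw [eq_div_iff (hden i), num]
  simp only [map_add, map_mul, RatFunc.algebraMap_X, RatFunc.algebraMap_C, mul_inv, inv_inv]
  have h1 := mul_inv_cancel₀ (hq i)
  have h2 := mul_inv_cancel₀ (hden i)
  have h3 := hq i
  have h4 := hden i
  field_simp

theorem relativeDegree_Ww (k : Fin m → ℝ) (i : Fin m) : relativeDegree (S.Ww k i i) = 1 := by
  rw [Ww_eq_diagonal, diagonal_apply_eq,
    relativeDegree_div (S.num_ne_zero i) (S.den_ne_zero k i), natDegree_num, natDegree_den]
  norm_num

theorem aeval_num (i : Fin m) (s : ℂ) :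
    aeval s (S.num i) = S.φ i * (s + S.p i) * (s + S.θ i) := by
  simp [num]

theorem aeval_den (k : Fin m → ℝ) (i : Fin m) (s : ℂ) :
    aeval s (S.den k i)
      = (S.J i * s ^ 2 + S.b i * s) * (s + S.q i) + k i * S.φ i * (s + S.p i) := by
  simp [den]

theorem evalAt_Ww (k : Fin m → ℝ) (s : ℂ) (i : Fin m) (h : aeval s (S.den k i) ≠ 0) :
    (S.Ww k).evalAt s i i = aeval s (S.num i) / aeval s (S.den k i) := by
  rw [TransferMatrix.evalAt, map_apply, Ww_eq_diagonal, diagonal_apply_eq,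
    eval_div_mul_aeval (S.den_ne_zero k i) s h]

theorem evalAt_Ww_off_diag (k : Fin m → ℝ) (s : ℂ) {i j : Fin m} (h : i ≠ j) :
    (S.Ww k).evalAt s i j = 0 := by
  rw [TransferMatrix.evalAt, map_apply, Ww_eq_diagonal, diagonal_apply_ne _ h, RatFunc.eval_zero]

theorem evalAt_Ww_eq_diagonal (k : Fin m → ℝ) (s : ℂ) :
    (S.Ww k).evalAt s = diagonal fun i => (S.Ww k).evalAt s i i := by
  ext i j
  rcases eq_or_ne i j with rfl | h
  · simp
  · rw [diagonal_apply_ne _ h, evalAt_Ww_off_diag S k s h]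

theorem posSemidef_evalAt_Ww_iff (k : Fin m → ℝ) (s : ℂ) :
    ((S.Ww k).evalAt s + ((S.Ww k).evalAt s)ᴴ).PosSemidef ↔
      ∀ i, 0 ≤ ((S.Ww k).evalAt s i i).re := by
  rw [evalAt_Ww_eq_diagonal, diagonal_conjTranspose, diagonal_add, posSemidef_diagonal_iff]
  refine forall_congr' fun i => ?_
  rw [diagonal_apply_eq, Pi.star_apply, Complex.star_def, Complex.add_conj]
  constructor
  · intro h
    have : (0 : ℝ) ≤ 2 * ((S.Ww k).evalAt s i i).re := by exact_mod_cast h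
    linarith
  · intro h
    have : (0 : ℝ) ≤ 2 * ((S.Ww k).evalAt s i i).re := by linarith
    exact_mod_cast this

theorem aeval_num_ne_zero (i : Fin m) {s : ℂ} (hp : -S.p i < s.re) (hθ : -S.θ i < s.re) :
    aeval s (S.num i) ≠ 0 := by
  rw [aeval_num]
  refine mul_ne_zero (mul_ne_zero (by exact_mod_cast (S.φ_pos i).ne') fun h => ?_) fun h => ?_
  · have := congrArg Complex.re h
    simp at this; linarith
  · have := congrArg Complex.re h
    simp at this; linarith

/-- If the inverse channels have nonnegative real part on a half-plane, `W_w` is SPR. -/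
theorem isSPR_of_re_div_nonneg (k : Fin m → ℝ) {ε : ℝ} (hε : 0 < ε)
    (h : ∀ i (s : ℂ), -ε < s.re → aeval s (S.den k i) ≠ 0 ∧
      0 ≤ (aeval s (S.num i) / aeval s (S.den k i)).re) : (S.Ww k).IsSPR := by
  have hshift : ∀ s : ℂ, 0 < s.re → -ε < (s - ε).re := by
    intro s hs; simp; linarith
  refine ⟨ε, hε, fun i j s hs => ?_, fun s hs => ?_⟩
  · rcases eq_or_ne i j with rfl | hij
    · have h1 : AnalyticAt ℂ (fun s : ℂ => aeval (s - ε) (S.num i) / aeval (s - ε) (S.den k i)) s := by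
        refine AnalyticAt.div ?_ ?_ (h i _ (hshift s hs)).1
        · simp only [aeval_num]; fun_prop
        · simp only [aeval_den]; fun_prop
      refine h1.congr ?_
      have hopen : IsOpen {s : ℂ | 0 < s.re} := isOpen_lt continuous_const Complex.continuous_re
      filter_upwards [hopen.mem_nhds hs] with z hz
      exact (S.evalAt_Ww k _ i (h i _ (hshift z hz)).1).symm
    · simp only [evalAt_Ww_off_diag S k _ hij]
      exact analyticAt_const
  · rw [posSemidef_evalAt_Ww_iff]
    intro i
    rw [S.evalAt_Ww k _ i (h i _ (hshift s hs)).1]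
    exact (h i _ (hshift s hs)).2

/-- SPR constrains the evaluation map, which takes the junk value `0` at poles. Analyticity excludes
poles, so the constraint passes to the explicit quotient on an open half-plane containing the closed
right one. -/
theorem exists_re_div_nonneg_of_isSPR (k : Fin m → ℝ) (h : (S.Ww k).IsSPR) (i : Fin m) :
    ∃ ε : ℝ, 0 < ε ∧ ∀ s : ℂ, -ε < s.re → aeval s (S.num i) ≠ 0 ∧ aeval s (S.den k i) ≠ 0 ∧
      0 ≤ (aeval s (S.num i) / aeval s (S.den k i)).re := by
  obtain ⟨ε, hε, han, hpos⟩ := h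
  -- Staying to the right of `-p` and `-θ` keeps the numerator nonzero, so a zero of `den` cannot be
  -- cancelled.
  refine ⟨min ε (min (S.p i) (S.θ i)), lt_min hε (lt_min (S.p_pos i) (S.θ_pos i)), fun s hs => ?_⟩
  have hs1 : -ε < s.re := by linarith [min_le_left ε (min (S.p i) (S.θ i))]
  have hs2 : -S.p i < s.re := by
    linarith [min_le_right ε (min (S.p i) (S.θ i)), min_le_left (S.p i) (S.θ i)]
  have hs3 : -S.θ i < s.re := by
    linarith [min_le_right ε (min (S.p i) (S.θ i)), min_le_right (S.p i) (S.θ i)]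
  have hnum := S.aeval_num_ne_zero i hs2 hs3
  have hs4 : 0 < (s + ε).re := by simp; linarith
  have hcont : ContinuousAt (fun z : ℂ => (S.Ww k).evalAt z i i) s := by
    have h1 := (han i i (s + ε) hs4).continuousAt
    have h2 : ContinuousAt (fun z : ℂ => z + (ε : ℂ)) s := by fun_prop
    have h3 := ContinuousAt.comp (f := fun z : ℂ => z + (ε : ℂ)) h1 h2
    refine h3.congr (Eventually.of_forall fun z => ?_)
    simp
  -- Near a zero of `den`, `den * W = num` off the finitely many roots while `W` is continuous; the
  -- limit would give `num = 0`.
  have hden : aeval s (S.den k i) ≠ 0 := by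
    intro h0
    have hlim1 : Tendsto (fun z : ℂ => aeval z (S.den k i) * (S.Ww k).evalAt z i i) (𝓝[≠] s)
        (𝓝 0) := by
      have h1 : ContinuousAt (fun z : ℂ => aeval z (S.den k i)) s := by
        simp only [aeval_den]; fun_prop
      have h2 := h1.tendsto.mul hcont.tendsto
      rw [h0, zero_mul] at h2
      exact h2.mono_left nhdsWithin_le_nhds
    have hlim2 : Tendsto (fun z : ℂ => aeval z (S.num i)) (𝓝[≠] s) (𝓝 (aeval s (S.num i))) := by
      have h1 : ContinuousAt (fun z : ℂ => aeval z (S.num i)) s := by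
        simp only [aeval_num]; fun_prop
      exact h1.tendsto.mono_left nhdsWithin_le_nhds
    have hev : ∀ᶠ z in 𝓝[≠] s, aeval z (S.den k i) ≠ 0 := by
      have hfin : {z : ℂ | aeval z (S.den k i) = 0}.Finite := by
        refine (((S.den k i).map (algebraMap ℝ ℂ)).rootSet_finite ℂ).subset fun z hz => ?_
        rw [mem_rootSet]
        refine ⟨(Polynomial.map_ne_zero_iff (algebraMap ℝ ℂ).injective).2 (S.den_ne_zero k i), ?_⟩
        rw [aeval_map_algebraMap]
        exact hz
      have := (hfin.subset (Set.sdiff_subset (t := {s}))).isClosed.isOpen_compl.mem_nhds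
        (x := s) (by simp)
      filter_upwards [nhdsWithin_le_nhds this, self_mem_nhdsWithin] with z hz hzs h
      exact hz ⟨h, hzs⟩
    refine hnum (tendsto_nhds_unique hlim2 (hlim1.congr' ?_))
    filter_upwards [hev] with z hz
    rw [S.evalAt_Ww k z i hz, mul_div_cancel₀ _ hz]
  refine ⟨hnum, hden, ?_⟩
  have h1 := (S.posSemidef_evalAt_Ww_iff k (s + ε - ε)).1 (hpos (s + ε) hs4) i
  rw [add_sub_cancel_right, S.evalAt_Ww k s i hden] at h1
  exact h1

/-- Bounding the reciprocal channel makes the gain enter linearly. With `t = ‖s + θ‖⁻¹`, its partial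
fractions are bounded below by a quadratic in `t`, and the gain controls the leading coefficient. -/
theorem re_den_div_num_pos {J b φ p q θ k : ℝ} (hJ : 0 < J) (hφ : 0 < φ) (hp : 0 < p) (hθ : 0 < θ)
    {c₀ α γ : ℝ} (hc₀ : c₀ = b + J * (q - p - θ)) (hc₀_pos : 0 < c₀)
    (hα : α = b * q - c₀ * (p + θ) - J * p * θ) (hγ : γ = -c₀ * p * θ - α * p)
    (hk : (2 * |γ| / p) ^ 2 / (c₀ * θ) + 1 ≤ k * φ + α) {s : ℂ}
    (hsp : -(p / 2) < s.re) (hsθ : -(θ / 2) < s.re) (hsJ : -(c₀ / (2 * J)) < s.re) :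
    0 < (((J * s ^ 2 + b * s) * (s + q) + k * φ * (s + p)) / (φ * (s + p) * (s + θ))).re := by
  have hp0 : s + p ≠ 0 := fun h => by
    have := congrArg Complex.re h; simp at this; linarith
  have hθ0 : s + θ ≠ 0 := fun h => by
    have := congrArg Complex.re h; simp at this; linarith
  have hφ0 : (φ : ℂ) ≠ 0 := by exact_mod_cast hφ.ne'
  have hdecomp : ((J * s ^ 2 + b * s) * (s + q) + k * φ * (s + p)) / (φ * (s + p) * (s + θ))
      = ((φ⁻¹ : ℝ) : ℂ) * (J * s + c₀ + ((k * φ + α : ℝ) : ℂ) * (s + θ)⁻¹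
        + γ * ((s + p)⁻¹ * (s + θ)⁻¹)) := by
    rw [hγ, hα, hc₀]
    push_cast
    field_simp
    ring
  rw [hdecomp, Complex.re_ofReal_mul]
  refine mul_pos (inv_pos.2 hφ) ?_
  have hc : 0 ≤ k * φ + α := le_trans (by positivity) hk
  set t : ℝ := ‖s + θ‖⁻¹ with ht
  have ht0 : 0 < t := inv_pos.2 (norm_pos_iff.2 hθ0)
  have h1 : θ / 2 * t ^ 2 ≤ ((s + θ)⁻¹).re := by
    rw [Complex.inv_re, Complex.normSq_eq_norm_sq, ht, inv_pow, div_eq_mul_inv]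
    refine mul_le_mul_of_nonneg_right ?_ (by positivity)
    simp; linarith
  have h2 : -(2 * |γ| / p * t) ≤ (γ * ((s + p)⁻¹ * (s + θ)⁻¹)).re := by
    have h3 : p / 2 ≤ ‖s + p‖ := by
      refine le_trans ?_ (Complex.re_le_norm _)
      simp; linarith
    have h4 : ‖s + p‖⁻¹ ≤ 2 / p := by
      rw [← inv_div]; exact inv_anti₀ (by positivity) h3
    have h5 : ‖(γ : ℂ) * ((s + p)⁻¹ * (s + θ)⁻¹)‖ ≤ 2 * |γ| / p * t := by
      rw [norm_mul, norm_mul, norm_inv, norm_inv, Complex.norm_real, Real.norm_eq_abs]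
      calc |γ| * (‖s + p‖⁻¹ * t) ≤ |γ| * (2 / p * t) := by gcongr
        _ = 2 * |γ| / p * t := by ring
    exact (abs_le.1 ((Complex.abs_re_le_norm _).trans h5)).1
  have h3 : c₀ / 2 < J * s.re + c₀ := by
    have : J * -(c₀ / (2 * J)) < J * s.re := mul_lt_mul_of_pos_left hsJ hJ
    have h4 : J * -(c₀ / (2 * J)) = -(c₀ / 2) := by field_simp
    linarith
  have h4 : (k * φ + α) * (θ / 2 * t ^ 2) ≤ (((k * φ + α : ℝ) : ℂ) * (s + θ)⁻¹).re := by
    rw [Complex.re_ofReal_mul]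
    exact mul_le_mul_of_nonneg_left h1 hc
  -- At the threshold value `d² / (c₀ θ)` of `kφ + α` the quadratic is a perfect square. Strict
  -- positivity of the whole comes from the strict bound `h3`.
  have h5 : 0 ≤ c₀ / 2 - 2 * |γ| / p * t + (k * φ + α) * (θ / 2 * t ^ 2) := by
    set d := 2 * |γ| / p with hd
    have h6 : (d ^ 2 / (c₀ * θ)) * (θ / 2 * t ^ 2) ≤ (k * φ + α) * (θ / 2 * t ^ 2) :=
      mul_le_mul_of_nonneg_right (by linarith) (by positivity)
    have h7 : c₀ / 2 - d * t + (d ^ 2 / (c₀ * θ)) * (θ / 2 * t ^ 2)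
        = (c₀ - d * t) ^ 2 / (2 * c₀) := by
      field_simp
      ring
    have h8 : 0 ≤ (c₀ - d * t) ^ 2 / (2 * c₀) := by positivity
    linarith
  have h6 : (J * s + c₀ : ℂ).re = J * s.re + c₀ := by simp
  rw [Complex.add_re, Complex.add_re, h6]
  linarith

theorem exists_gain_isSPR (h : ∀ i, S.θ i < S.q i - S.p i + S.b i / S.J i) :
    ∃ κ : ℝ, ∀ k : Fin m → ℝ, (∀ i, κ ≤ k i) → (S.Ww k).IsSPR := by
  set c₀ : Fin m → ℝ := fun i => S.b i + S.J i * (S.q i - S.p i - S.θ i) with hc₀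
  set α : Fin m → ℝ := fun i =>
    S.b i * S.q i - c₀ i * (S.p i + S.θ i) - S.J i * S.p i * S.θ i with hα
  set γ : Fin m → ℝ := fun i => -c₀ i * S.p i * S.θ i - α i * S.p i with hγ
  -- This is the hypothesis on `θ` multiplied by `J`.
  have hc₀_pos : ∀ i, 0 < c₀ i := by
    intro i
    have h1 := mul_lt_mul_of_pos_left (h i) (S.J_pos i)
    rw [mul_add, mul_div_cancel₀ _ (S.J_pos i).ne'] at h1
    simp only [hc₀]
    linarith
  obtain ⟨κ, hκ⟩ := (Set.finite_range fun i =>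
    ((2 * |γ i| / S.p i) ^ 2 / (c₀ i * S.θ i) + 1 - α i) / S.φ i).bddAbove
  obtain ⟨ε, hε, hεle⟩ : ∃ ε : ℝ, 0 < ε ∧
      ∀ i, ε ≤ min (S.p i / 2) (min (S.θ i / 2) (c₀ i / (2 * S.J i))) := by
    rcases isEmpty_or_nonempty (Fin m) with hm | hm
    · exact ⟨1, one_pos, fun i => (hm.false i).elim⟩
    · obtain ⟨i, hi⟩ := Finite.exists_min fun i =>
        min (S.p i / 2) (min (S.θ i / 2) (c₀ i / (2 * S.J i)))
      refine ⟨_, ?_, hi⟩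
      have := S.p_pos i
      have := S.θ_pos i
      have := S.J_pos i
      have := hc₀_pos i
      positivity
  refine ⟨κ, fun k hk => S.isSPR_of_re_div_nonneg k hε fun i s hs => ?_⟩
  obtain ⟨h1, h2⟩ := le_min_iff.1 (hεle i)
  obtain ⟨h2, h3⟩ := le_min_iff.1 h2
  have hki : (2 * |γ i| / S.p i) ^ 2 / (c₀ i * S.θ i) + 1 ≤ k i * S.φ i + α i := by
    have := (hκ ⟨i, rfl⟩).trans (hk i)
    rw [div_le_iff₀ (S.φ_pos i)] at this
    linarith
  have hpos := re_den_div_num_pos (S.J_pos i) (S.φ_pos i) (S.p_pos i) (S.θ_pos i) (q := S.q i)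
    rfl (hc₀_pos i) rfl rfl hki (s := s) (by linarith) (by linarith) (by linarith)
  rw [← aeval_den, ← aeval_num] at hpos
  have hden : aeval s (S.den k i) ≠ 0 := by
    intro h0
    rw [h0] at hpos
    simp at hpos
  refine ⟨hden, ?_⟩
  rw [← inv_div, Complex.inv_re]
  exact div_nonneg hpos.le (Complex.normSq_nonneg _)

/-- In the variable `1/s` the function is continuous at `0`, where its value is the ratio of leading
coefficients. -/
theorem tendsto_mul_num_div_den {ι : Type*} {l : Filter ι} (k : Fin m → ℝ) (i : Fin m) {s : ι → ℂ}
    (hs0 : ∀ᶠ t in l, s t ≠ 0) (hs : Tendsto (fun t => (s t)⁻¹) l (𝓝 0)) :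
    Tendsto (fun t => s t * (aeval (s t) (S.num i) / aeval (s t) (S.den k i))) l
      (𝓝 ((S.φ i / S.J i : ℝ) : ℂ)) := by
  have hJ : (S.J i : ℂ) ≠ 0 := by exact_mod_cast (S.J_pos i).ne'
  have hcont : ContinuousAt (fun z : ℂ => (S.φ i * (1 + S.p i * z) * (1 + S.θ i * z))
      / ((S.J i + S.b i * z) * (1 + S.q i * z) + k i * S.φ i * (z ^ 2 * (1 + S.p i * z)))) 0 := by
    refine ContinuousAt.div (by fun_prop) (by fun_prop) ?_
    simpa using hJ
  have h1 := hcont.tendsto.comp hs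
  have h2 : (((S.φ i / S.J i : ℝ)) : ℂ) = (S.φ i * (1 + S.p i * (0 : ℂ)) * (1 + S.θ i * (0 : ℂ)))
      / ((S.J i + S.b i * (0 : ℂ)) * (1 + S.q i * (0 : ℂ))
        + k i * S.φ i * ((0 : ℂ) ^ 2 * (1 + S.p i * (0 : ℂ)))) := by
    simp
  rw [h2]
  refine h1.congr' ?_
  filter_upwards [hs0] with t ht
  rw [Function.comp_apply, aeval_num, aeval_den, mul_div_assoc']
  have e1 : s t * (S.φ i * (s t + S.p i) * (s t + S.θ i)) = s t ^ 3
      * (S.φ i * (1 + S.p i * (s t)⁻¹) * (1 + S.θ i * (s t)⁻¹)) := by field_simp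
  have e2 : (S.J i * s t ^ 2 + S.b i * s t) * (s t + S.q i) + k i * S.φ i * (s t + S.p i)
      = s t ^ 3 * ((S.J i + S.b i * (s t)⁻¹) * (1 + S.q i * (s t)⁻¹)
        + k i * S.φ i * ((s t)⁻¹ ^ 2 * (1 + S.p i * (s t)⁻¹))) := by field_simp
  rw [e1, e2, mul_div_mul_left _ _ (pow_ne_zero 3 ht)]

/-- On the half-plane where the channel is positive real, its real part is positive. -/
theorem re_num_div_den_pos (k : Fin m → ℝ) (i : Fin m) {ε : ℝ}
    (h : ∀ s : ℂ, -ε < s.re → aeval s (S.num i) ≠ 0 ∧ aeval s (S.den k i) ≠ 0 ∧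
      0 ≤ (aeval s (S.num i) / aeval s (S.den k i)).re) {s : ℂ} (hs : -ε < s.re) :
    0 < (aeval s (S.num i) / aeval s (S.den k i)).re := by
  set f : ℂ → ℂ := fun s => aeval s (S.num i) / aeval s (S.den k i) with hf
  set U : Set ℂ := {s : ℂ | -ε < s.re} with hU
  have hUo : IsOpen U := isOpen_lt continuous_const Complex.continuous_re
  have han : AnalyticOnNhd ℂ f U := by
    intro z hz
    refine AnalyticAt.div ?_ ?_ (h z hz).2.1
    · simp only [aeval_num]; fun_prop
    · simp only [aeval_den]; fun_prop
  have hconn : IsPreconnected U := (convex_halfSpace_re_gt (-ε)).isPreconnected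
  rcases han.is_constant_or_isOpen hconn with ⟨w, hw⟩ | hopen
  -- A constant channel would be `0`, since it decays like `1/s` along the positive reals; but its
  -- numerator does not vanish.
  · exfalso
    have hinv : Tendsto (fun t : ℝ => ((t : ℂ))⁻¹) atTop (𝓝 0) := by
      have := (Complex.continuous_ofReal.tendsto 0).comp tendsto_inv_atTop_zero
      refine (this.congr fun t => ?_).trans (by simp)
      simp
    have h0 : ∀ᶠ t : ℝ in atTop, (t : ℂ) ≠ 0 := by
      filter_upwards [eventually_gt_atTop 0] with t ht
      exact_mod_cast ht.ne'
    have h1 := hinv.mul (S.tendsto_mul_num_div_den k i h0 hinv)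
    rw [zero_mul] at h1
    have h2 : Tendsto (fun _ : ℝ => w) atTop (𝓝 0) := by
      refine h1.congr' ?_
      filter_upwards [h0, eventually_gt_atTop (-ε)] with t ht htε
      rw [← mul_assoc, inv_mul_cancel₀ ht, one_mul]
      exact hw t (by simpa [hU] using htε)
    have hw0 : w = 0 := tendsto_nhds_unique tendsto_const_nhds h2
    have := hw s hs
    rw [hw0] at this
    exact div_ne_zero (h s hs).1 (h s hs).2.1 this
  -- Open mapping: a value with zero real part would have a neighbouring value with negative real
  -- part in the image.
  · refine lt_of_le_of_ne (h s hs).2.2 fun h0 => ?_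
    have himg := hopen U subset_rfl hUo
    obtain ⟨δ, hδ, hball⟩ := Metric.isOpen_iff.1 himg (f s) ⟨s, hs, rfl⟩
    obtain ⟨z, hz, hfz⟩ := hball (a := f s - ((δ / 2 : ℝ) : ℂ)) (by
      rw [Metric.mem_ball, dist_eq_norm, sub_sub_cancel_left, norm_neg, Complex.norm_real,
        Real.norm_of_nonneg (by positivity)]
      linarith)
    have h1 := (h z hz).2.2
    have h2 : (f z).re = -(δ / 2) := by
      rw [hfz, Complex.sub_re, Complex.ofReal_re, ← h0]; ring
    change 0 ≤ (f z).re at h1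
    linarith

end ShapedDesign

/-! ### The network: the error determines the deviation from the leader -/

namespace LeaderNetwork

variable {m : ℕ} (G : LeaderNetwork m)

theorem lap_eq : G.lap = 1 - G.adj := by
  rw [lap, leadMatrix, sub_add_eq_add_sub, diagonal_add]
  simp [G.balanced]

theorem syncError_eq (x : Fin m → ℝ) (x0 : ℝ) :
    G.syncError x x0 = -(G.lap *ᵥ fun i => x i - x0) := by
  have h : G.lap *ᵥ (fun _ => x0) = G.leadMatrix *ᵥ fun _ => x0 := by
    ext i
    rw [lap_eq, sub_mulVec, one_mulVec, leadMatrix, mulVec_diagonal, Pi.sub_apply]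
    simp only [mulVec, dotProduct]
    rw [← Finset.sum_mul]
    linear_combination -x0 * G.balanced i
  have h2 : (fun i => x i - x0) = x - fun _ => x0 := rfl
  rw [syncError, h2, mulVec_sub, h]
  abel

/-- Maximum principle: each `z i` is a subconvex combination of its neighbours' values. Where `|z
i|` is maximal, the leader weight must vanish and every in-neighbour must be maximal too; going back
along a path from the leader contradicts a positive leader weight. -/
theorem eq_zero_of_lap_mulVec_eq_zero {z : Fin m → ℝ} (hz : G.lap *ᵥ z = 0) : z = 0 := by
  rcases isEmpty_or_nonempty (Fin m) with hm | hm
  · exact Subsingleton.elim _ _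
  have hfix : ∀ i, z i = ∑ j, G.adj i j * z j := by
    intro i
    rw [lap_eq, sub_mulVec, one_mulVec, sub_eq_zero] at hz
    exact congrFun hz i
  obtain ⟨i₀, hi₀⟩ := Finite.exists_max fun i => |z i|
  set M := |z i₀| with hM
  by_contra hne
  have hMpos : 0 < M := by
    obtain ⟨j, hj⟩ := Function.ne_iff.1 hne
    exact (abs_pos.2 hj).trans_le (hi₀ j)
  have hbound : ∀ i, |z i| = M → G.lead i = 0 ∧ ∀ j, 0 < G.adj i j → |z j| = M := by
    intro i hi
    have h1 : M ≤ ∑ j, G.adj i j * |z j| := by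
      rw [← hi, hfix i]
      refine (Finset.abs_sum_le_sum_abs _ _).trans (Finset.sum_le_sum fun j _ => ?_)
      rw [abs_mul, abs_of_nonneg (G.adj_nonneg i j)]
    have h2 : ∑ j, G.adj i j * (M - |z j|) = (1 - G.lead i) * M - ∑ j, G.adj i j * |z j| := by
      simp only [mul_sub, Finset.sum_sub_distrib]
      rw [← Finset.sum_mul, ← G.balanced i]; ring
    have hterm : ∀ j, 0 ≤ G.adj i j * (M - |z j|) := fun j =>
      mul_nonneg (G.adj_nonneg i j) (sub_nonneg.2 (hi₀ j))
    have h3 : 0 ≤ ∑ j, G.adj i j * (M - |z j|) := Finset.sum_nonneg fun j _ => hterm j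
    have h4 := mul_nonneg (G.lead_nonneg i) hMpos.le
    refine ⟨?_, fun j hj => ?_⟩
    · have : G.lead i * M = 0 := by nlinarith
      exact (mul_eq_zero.1 this).resolve_right hMpos.ne'
    · have h5 : ∑ j, G.adj i j * (M - |z j|) = 0 := by nlinarith
      have h6 := (Finset.sum_eq_zero_iff_of_nonneg fun j _ => hterm j).1 h5 j (Finset.mem_univ j)
      have := (mul_eq_zero.1 h6).resolve_left hj.ne'
      linarith
  obtain ⟨k, hk, hpath⟩ := G.reachable i₀
  have hkM : |z k| = M := by
    clear hk
    induction hpath using Relation.ReflTransGen.head_induction_on with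
    | refl => rfl
    | head hab _ ih => exact (hbound _ ih).2 _ hab
  exact hk.ne' (hbound k hkM).1

theorem isUnit_det_lap : IsUnit G.lap.det := by
  rw [← isUnit_iff_isUnit_det, ← mulVec_injective_iff_isUnit, ← coe_mulVecLin,
    injective_iff_map_eq_zero]
  exact fun z hz => G.eq_zero_of_lap_mulVec_eq_zero hz

theorem tendsto_sub_of_tendsto_syncError {x : ℝ → Fin m → ℝ} {x0 : ℝ → ℝ}
    (h : Tendsto (fun t => G.syncError (x t) (x0 t)) atTop (𝓝 0)) (i : Fin m) :
    Tendsto (fun t => x t i - x0 t) atTop (𝓝 0) := by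
  have h1 : ∀ t, (fun i => x t i - x0 t) = G.lap⁻¹ *ᵥ -(G.syncError (x t) (x0 t)) := by
    intro t
    rw [syncError_eq, neg_neg, mulVec_mulVec, nonsing_inv_mul _ G.isUnit_det_lap, one_mulVec]
  have hcont : Continuous fun e : Fin m → ℝ => (G.lap⁻¹ *ᵥ -e) i := by fun_prop
  have h2 := (hcont.tendsto 0).comp h
  simp only [neg_zero, mulVec_zero, Pi.zero_apply] at h2
  exact h2.congr fun t => (congrFun (h1 t) i).symm

end LeaderNetwork

/-! ### Splitting a trace into single-frequency vectors -/

section FrequencyTrace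

variable {V X Y : Type*} [NormedAddCommGroup V] [InnerProductSpace ℂ V] [FiniteDimensional ℂ V]
  [NormedAddCommGroup X] [InnerProductSpace ℂ X] [FiniteDimensional ℂ X]
  [AddCommGroup Y] [Module ℂ Y]

/-- If `f g† + g f† = 0` on a nontrivial space, some nonzero vector satisfies `f w = 0` or
`g w = iω f w`. -/
theorem exists_frequency_vector [Nontrivial V] (f g : V →ₗ[ℂ] X)
    (h : f ∘ₗ g.adjoint + g ∘ₗ f.adjoint = 0) :
    ∃ w : V, w ≠ 0 ∧ (f w = 0 ∨ ∃ ω : ℝ, g w = ((ω : ℂ) * Complex.I) • f w) := by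
  by_cases hf : Function.Injective f
  swap
  · obtain ⟨w, hw, hw0⟩ : ∃ w, f w = 0 ∧ w ≠ 0 := by
      by_contra! hc
      exact hf ((injective_iff_map_eq_zero f).2 hc)
    exact ⟨w, hw0, Or.inl hw⟩
  have hsurj : f.adjoint.range = ⊤ := by
    have h1 : f.adjoint.rangeᗮ = ⊥ := by
      rw [LinearMap.orthogonal_range, LinearMap.adjoint_adjoint, LinearMap.ker_eq_bot.2 hf]
    simpa using h1
  obtain ⟨R, hR⟩ := f.adjoint.exists_rightInverse_of_surjective hsurj
  -- With `R` a right inverse of `f†`, the relation gives `g = g f† R = -f g† R = f S`. Substituting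
  -- it back shows that `S` is skew-adjoint, so its eigenvalues are imaginary.
  set S : V →ₗ[ℂ] V := -(g.adjoint ∘ₗ R) with hS
  have hg : g = f ∘ₗ S := by
    have h1 : g ∘ₗ f.adjoint = -(f ∘ₗ g.adjoint) := by
      rw [eq_neg_iff_add_eq_zero, add_comm]; exact h
    calc g = g ∘ₗ (f.adjoint ∘ₗ R) := by rw [hR, LinearMap.comp_id]
      _ = f ∘ₗ S := by
        rw [← LinearMap.comp_assoc, h1, hS]
        ext; simp
  have hskew : S.adjoint + S = 0 := by
    have h2 : f ∘ₗ ((S.adjoint + S) ∘ₗ f.adjoint) = 0 := by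
      rw [← h, hg]
      ext x
      simp [LinearMap.adjoint_comp]
    ext v
    obtain ⟨x, rfl⟩ : ∃ x, f.adjoint x = v := by
      simpa using hsurj.ge (Submodule.mem_top (x := v))
    apply hf
    have := LinearMap.congr_fun h2 x
    simpa using this
  obtain ⟨lam, hlam⟩ := Module.End.exists_eigenvalue S
  obtain ⟨w, hw⟩ := hlam.exists_hasEigenvector
  have hw1 : S w = lam • w := hw.apply_eq_smul
  refine ⟨w, hw.2, Or.inr ⟨lam.im, ?_⟩⟩
  have h3 : (starRingEnd ℂ lam + lam) * inner ℂ w w = 0 := by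
    have h4 : inner ℂ w ((S.adjoint + S) w) = 0 := by simp [hskew]
    rw [LinearMap.add_apply, inner_add_right, LinearMap.adjoint_inner_right, hw1,
      inner_smul_left, inner_smul_right] at h4
    rw [add_mul]; exact h4
  have h5 : starRingEnd ℂ lam + lam = 0 := by
    rcases mul_eq_zero.1 h3 with h | h
    · exact h
    · exact absurd (inner_self_eq_zero.1 h) hw.2
  have h6 : lam = (lam.im : ℂ) * Complex.I := by
    have := congrArg Complex.re h5
    simp at this
    apply Complex.ext <;> simp
    linarith
  rw [hg, LinearMap.comp_apply, hw1, map_smul, ← h6]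

theorem subtype_comp_adjoint_orthogonal_singleton (w : V) (hw : ‖w‖ = 1) :
    ((ℂ ∙ w)ᗮ).subtype ∘ₗ ((ℂ ∙ w)ᗮ).subtype.adjoint
      = LinearMap.id - (InnerProductSpace.rankOne ℂ w w : V →L[ℂ] V).toLinearMap := by
  ext v
  have hmem : v - (inner ℂ w v) • w ∈ (ℂ ∙ w)ᗮ := by
    rw [Submodule.mem_orthogonal_singleton_iff_inner_right, inner_sub_right, inner_smul_right,
      inner_self_eq_norm_sq_to_K, hw]
    simp
  have h1 : ((ℂ ∙ w)ᗮ).subtype.adjoint v = ⟨v - (inner ℂ w v) • w, hmem⟩ := by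
    refine ext_inner_right ℂ fun y => ?_
    rw [LinearMap.adjoint_inner_left]
    have hy := (Submodule.mem_orthogonal_singleton_iff_inner_right).1 y.2
    simp [inner_sub_left, inner_smul_left, hy]
  simp [h1]

/-- Induction on the dimension: split off a unit frequency vector `w` and pass to its orthogonal
complement. The relation survives because the terms `f w ⊗ g w` and `g w ⊗ f w` cancel when `g w =
iω f w`, and the trace splits accordingly. The map `k` records the equality case. -/
theorem re_trace_nonneg_of_frequency (r : ℕ) :
    ∀ (V : Type) [NormedAddCommGroup V] [InnerProductSpace ℂ V] [FiniteDimensional ℂ V]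
      (f g : V →ₗ[ℂ] X) (T : V →ₗ[ℂ] V) (k : V →ₗ[ℂ] Y), Module.finrank ℂ V = r →
      f ∘ₗ g.adjoint + g ∘ₗ f.adjoint = 0 →
      (∀ w, (f w = 0 ∨ ∃ ω : ℝ, g w = ((ω : ℂ) * Complex.I) • f w) →
        0 ≤ (inner ℂ w (T w)).re ∧ ((inner ℂ w (T w)).re = 0 → k w = 0)) →
      0 ≤ (LinearMap.trace ℂ V T).re ∧ ((LinearMap.trace ℂ V T).re = 0 → k = 0) := by
  induction r with
  | zero =>
    intro V _ _ _ f g T k hr _ _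
    have : Subsingleton V := Module.finrank_zero_iff.1 hr
    have hT : T = 0 := Subsingleton.elim _ _
    refine ⟨by simp [hT], fun _ => ?_⟩
    ext v
    rw [Subsingleton.elim v 0, map_zero, map_zero]
  | succ r ih =>
    intro V _ _ _ f g T k hr hfg hT
    have : Nontrivial V := Module.nontrivial_of_finrank_pos (R := ℂ) (by omega)
    obtain ⟨w₀, hw₀, hw₁⟩ := exists_frequency_vector f g hfg
    obtain ⟨w, hwn, hw⟩ : ∃ w : V, ‖w‖ = 1 ∧
        (f w = 0 ∨ ∃ ω : ℝ, g w = ((ω : ℂ) * Complex.I) • f w) := by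
      refine ⟨((‖w₀‖ : ℂ)⁻¹) • w₀, ?_, ?_⟩
      · simp [norm_smul, hw₀]
      · rcases hw₁ with h | ⟨ω, h⟩
        · left; simp [h]
        · right; exact ⟨ω, by rw [map_smul, map_smul, h, smul_comm]⟩
    have hw0 : w ≠ 0 := by rintro rfl; simp at hwn
    set W := (ℂ ∙ w)ᗮ with hW
    set ι : W →ₗ[ℂ] V := W.subtype with hι
    have hιι := subtype_comp_adjoint_orthogonal_singleton w hwn
    have hrank : Module.finrank ℂ W = r := by
      have h1 := Submodule.finrank_add_finrank_orthogonal (ℂ ∙ w)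
      rw [finrank_span_singleton hw0, hr] at h1
      rw [hW]
      omega
    have hcomp : ∀ a b : V →ₗ[ℂ] X, (a ∘ₗ ι) ∘ₗ (b ∘ₗ ι).adjoint
        = a ∘ₗ b.adjoint - (InnerProductSpace.rankOne ℂ (a w) (b w) : X →L[ℂ] X).toLinearMap := by
      intro a b
      have : (a ∘ₗ ι) ∘ₗ (b ∘ₗ ι).adjoint = a ∘ₗ (ι ∘ₗ ι.adjoint) ∘ₗ b.adjoint := by
        rw [LinearMap.adjoint_comp]; rfl
      rw [this, hιι]
      ext x
      simp [LinearMap.adjoint_inner_right]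
    obtain ⟨h1, h2⟩ := ih W (f ∘ₗ ι) (g ∘ₗ ι) (ι.adjoint ∘ₗ T ∘ₗ ι) (k ∘ₗ ι) hrank (by
        rw [hcomp, hcomp]
        have h3 : (InnerProductSpace.rankOne ℂ (f w) (g w) : X →L[ℂ] X).toLinearMap
            + (InnerProductSpace.rankOne ℂ (g w) (f w) : X →L[ℂ] X).toLinearMap = 0 := by
          ext x
          rcases hw with h | ⟨ω, h⟩
          · simp [h]
          · simp [h]
        calc _ = (f ∘ₗ g.adjoint + g ∘ₗ f.adjoint) -
              ((InnerProductSpace.rankOne ℂ (f w) (g w) : X →L[ℂ] X).toLinearMap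
            + (InnerProductSpace.rankOne ℂ (g w) (f w) : X →L[ℂ] X).toLinearMap) := by abel
          _ = 0 := by rw [h3, hfg, sub_zero])
      (by
        intro v hv
        have := hT (ι v) hv
        simpa [LinearMap.adjoint_inner_right] using this)
    obtain ⟨h3, h4⟩ := hT w hw
    have htr : LinearMap.trace ℂ V T
        = inner ℂ w (T w) + LinearMap.trace ℂ W (ι.adjoint ∘ₗ T ∘ₗ ι) := by
      have e1 : LinearMap.trace ℂ W (ι.adjoint ∘ₗ T ∘ₗ ι)
          = LinearMap.trace ℂ V (T ∘ₗ (ι ∘ₗ ι.adjoint)) := by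
        exact LinearMap.trace_comp_comm' (T ∘ₗ ι) ι.adjoint
      have e2 : T ∘ₗ (ι ∘ₗ ι.adjoint)
          = T - (InnerProductSpace.rankOne ℂ (T w) w : V →L[ℂ] V).toLinearMap := by
        rw [hιι]; ext x; simp
      rw [e1, e2, map_sub, InnerProductSpace.trace_rankOne]
      ring
    rw [htr, Complex.add_re]
    refine ⟨by linarith, fun h0 => ?_⟩
    have hk1 := h4 (by linarith)
    have hk2 := h2 (by linarith)
    ext v
    have hv : v = (inner ℂ w v) • w + ι (ι.adjoint v) := by
      have := LinearMap.congr_fun hιι v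
      simp only [LinearMap.comp_apply] at this
      rw [this]; simp
    have hk3 := LinearMap.congr_fun hk2 (ι.adjoint v)
    rw [hv, map_add, map_smul, hk1]
    simpa using hk3

end FrequencyTrace

/-! ### Kalman-Yakubovich-Popov lemma by convex separation -/

section KYP

variable {n m : ℕ}

/-- The matrix `Q = 1 - B diag(μ)⁻¹ cᵀ` eliminates the input: when `cᵀ B = diag μ` it satisfies `Q B
= 0`. The case `Q x = 0` is infinite frequency, governed by `ν < 0`; the other case is a motion at
frequency `ω`, governed by `hfreq`. -/
theorem re_cost_neg_of_frequency (A : Matrix (Fin n) (Fin n) ℂ) (B c : Matrix (Fin n) (Fin m) ℂ)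
    (hc : c.map star = c) (μ ν : Fin m → ℝ) (hμ : ∀ i, 0 < μ i) (hν : ∀ i, ν i < 0)
    (hcAB : cᵀ * A * B = diagonal fun i => (ν i : ℂ))
    (hfreq : ∀ (ω : ℝ) (x : Fin n → ℂ) (u : Fin m → ℂ), x ≠ 0 →
      ((ω : ℂ) * Complex.I) • x - A *ᵥ x = B *ᵥ u → 0 < (star (cᵀ *ᵥ x) ⬝ᵥ u).re)
    (x : Fin n → ℂ) (hx : x ≠ 0)
    (h : (1 - B * (diagonal fun i => (μ i : ℂ)⁻¹) * cᵀ) *ᵥ x = 0 ∨ ∃ ω : ℝ,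
      ((1 - B * (diagonal fun i => (μ i : ℂ)⁻¹) * cᵀ) * A) *ᵥ x
        = ((ω : ℂ) * Complex.I) • ((1 - B * (diagonal fun i => (μ i : ℂ)⁻¹) * cᵀ) *ᵥ x)) :
    (star x ⬝ᵥ ((c * (diagonal fun i => (μ i : ℂ)⁻¹) * cᵀ * A) *ᵥ x)).re < 0 := by
  set a : Matrix (Fin m) (Fin m) ℂ := diagonal fun i => (μ i : ℂ)⁻¹ with ha
  set y := cᵀ *ᵥ x with hy
  have hcost : star x ⬝ᵥ ((c * a * cᵀ * A) *ᵥ x) = star y ⬝ᵥ (a *ᵥ (cᵀ *ᵥ (A *ᵥ x))) := by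
    have h1 : star y = star x ᵥ* c := by
      rw [hy, star_mulVec, conjTranspose, transpose_transpose, hc]
    rw [h1, ← dotProduct_mulVec]
    simp only [mulVec_mulVec, Matrix.mul_assoc]
  have hre : ∀ z : Fin m → ℂ, ∀ d : Fin m → ℝ,
      (star z ⬝ᵥ (fun i => (d i : ℂ) * z i)).re = ∑ i, d i * Complex.normSq (z i) := by
    intro z d
    rw [dotProduct, Complex.re_sum]
    refine Finset.sum_congr rfl fun i _ => ?_
    simp [Complex.normSq_apply]
    ring
  rw [hcost]
  rcases h with h | ⟨ω, h⟩
  · have hxB : x = B *ᵥ (a *ᵥ y) := by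
      rw [sub_mulVec, one_mulVec, sub_eq_zero] at h
      simpa only [hy, mulVec_mulVec, Matrix.mul_assoc] using h
    have hy0 : y ≠ 0 := by
      intro h0
      rw [h0] at hxB
      simp at hxB
      exact hx hxB
    have h2 : cᵀ *ᵥ (A *ᵥ x) = (cᵀ * A * B) *ᵥ (a *ᵥ y) := by
      conv_lhs => rw [hxB]
      simp only [mulVec_mulVec, Matrix.mul_assoc]
    have h3 : a *ᵥ (cᵀ *ᵥ (A *ᵥ x)) = fun i => ((ν i * (μ i)⁻¹ ^ 2 : ℝ) : ℂ) * y i := by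
      rw [h2, hcAB, ha]
      ext i
      simp [mulVec_diagonal]
      ring
    rw [h3, hre]
    obtain ⟨i, hi⟩ := Function.ne_iff.1 hy0
    have hneg : ∀ j, ν j * (μ j)⁻¹ ^ 2 < 0 := fun j =>
      mul_neg_of_neg_of_pos (hν j) (pow_pos (inv_pos.2 (hμ j)) 2)
    refine Finset.sum_neg' (fun j _ => mul_nonpos_of_nonpos_of_nonneg (hneg j).le
      (Complex.normSq_nonneg _)) ⟨i, Finset.mem_univ i, ?_⟩
    exact mul_neg_of_neg_of_pos (hneg i) (Complex.normSq_pos.2 hi)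
  -- Undoing the elimination recovers an input `u` driving `x` at frequency `ω`. Its part `iω a y`
  -- does no real work on `y`, so the strict inequality falls on the cost.
  · have h1 : ((ω : ℂ) * Complex.I) • x - A *ᵥ x
        = B *ᵥ (((ω : ℂ) * Complex.I) • (a *ᵥ y) - a *ᵥ (cᵀ *ᵥ (A *ᵥ x))) := by
      rw [sub_mul, sub_mulVec, sub_mulVec, one_mul, one_mulVec, smul_sub] at h
      rw [mulVec_sub, mulVec_smul]
      simp only [hy, mulVec_mulVec, Matrix.mul_assoc] at h ⊢
      rw [sub_eq_sub_iff_add_eq_add] at h ⊢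
      rw [← h, add_comm]
    have h2 := hfreq ω x _ hx h1
    have h3 : (star y ⬝ᵥ (((ω : ℂ) * Complex.I) • (a *ᵥ y))).re = 0 := by
      rw [dotProduct_smul, smul_eq_mul]
      have h4 : a *ᵥ y = fun i => (((μ i)⁻¹ : ℝ) : ℂ) * y i := by
        ext i; simp [ha, mulVec_diagonal]
      have h5 : (star y ⬝ᵥ (a *ᵥ y)).im = 0 := by
        rw [h4, dotProduct, Complex.im_sum]
        refine Finset.sum_eq_zero fun i _ => ?_
        simp
        ring
      simp [h5]
    rw [dotProduct_sub, Complex.sub_re, h3] at h2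
    linarith

section Separation

attribute [local instance] Matrix.normedAddCommGroup Matrix.normedSpace

theorem isCompact_setOf_sum_norm_sq_eq_one :
    IsCompact {C : Matrix (Fin n) (Fin n) ℂ | ∑ i, ∑ j, ‖C i j‖ ^ 2 = 1} := by
  refine Metric.isCompact_of_isClosed_isBounded ?_ ?_
  · exact isClosed_eq (by fun_prop) continuous_const
  · refine (Metric.isBounded_closedBall (x := (0 : Matrix (Fin n) (Fin n) ℂ)) (r := 1)).subset ?_
    intro C hC
    rw [mem_closedBall_zero_iff, Matrix.norm_le_iff zero_le_one]
    intro i j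
    have h1 : ‖C i j‖ ^ 2 ≤ ∑ i, ∑ j, ‖C i j‖ ^ 2 :=
      (Finset.single_le_sum (f := fun j => ‖C i j‖ ^ 2) (fun _ _ => sq_nonneg _)
        (Finset.mem_univ j)).trans
      (Finset.single_le_sum (f := fun i => ∑ j, ‖C i j‖ ^ 2)
        (fun _ _ => Finset.sum_nonneg fun _ _ => sq_nonneg _) (Finset.mem_univ i))
    rw [hC] at h1
    exact (sq_le_one_iff₀ (norm_nonneg _)).1 h1

theorem trace_mul_conjTranspose_eq (C : Matrix (Fin n) (Fin n) ℂ) :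
    (C * Cᴴ).trace = ((∑ i, ∑ j, ‖C i j‖ ^ 2 : ℝ) : ℂ) := by
  simp only [trace, diag, mul_apply, conjTranspose_apply]
  push_cast
  refine Finset.sum_congr rfl fun i _ => Finset.sum_congr rfl fun j _ => ?_
  exact Complex.mul_conj' _

/-- The left side shows compactness, the right side convexity. -/
theorem image_mul_conjTranspose :
    (fun C : Matrix (Fin n) (Fin n) ℂ => C * Cᴴ) '' {C | ∑ i, ∑ j, ‖C i j‖ ^ 2 = 1}
      = {Z | Z.PosSemidef ∧ Z.trace = 1} := by
  ext Z
  constructor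
  · rintro ⟨C, hC, rfl⟩
    refine ⟨posSemidef_self_mul_conjTranspose C, ?_⟩
    have hC' : ∑ i, ∑ j, ‖C i j‖ ^ 2 = 1 := hC
    rw [trace_mul_conjTranspose_eq, hC']; simp
  · rintro ⟨hZ, htr⟩
    obtain ⟨D, hD⟩ : ∃ D : Matrix (Fin n) (Fin n) ℂ, Z = Dᴴ * D := by
      open scoped MatrixOrder in
      exact CStarAlgebra.nonneg_iff_eq_star_mul_self.1 hZ.nonneg
    refine ⟨Dᴴ, ?_, by simp [hD]⟩
    have := trace_mul_conjTranspose_eq Dᴴ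
    rw [conjTranspose_conjTranspose, ← hD, htr] at this
    exact_mod_cast this.symm

theorem convex_setOf_posSemidef_trace_eq_one :
    Convex ℝ {Z : Matrix (Fin n) (Fin n) ℂ | Z.PosSemidef ∧ Z.trace = 1} := by
  rintro Z ⟨hZ, hZt⟩ W ⟨hW, hWt⟩ s t hs ht hst
  refine ⟨?_, ?_⟩
  · have h1 := hZ.smul (a := (s : ℂ)) (by exact_mod_cast hs)
    have h2 := hW.smul (a := (t : ℂ)) (by exact_mod_cast ht)
    simpa using h1.add h2
  · rw [trace_add, trace_smul, trace_smul, hZt, hWt]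
    simp
    exact_mod_cast hst

/-- A frequency-domain inequality separates: there are `P` and `τ ≥ 0` certifying it. -/
theorem exists_separating_form (Q A N : Matrix (Fin n) (Fin n) ℝ)
    (hfreq : ∀ x : Fin n → ℂ, x ≠ 0 →
      ((Q.map Complex.ofReal *ᵥ x = 0) ∨ ∃ ω : ℝ, (Q * A).map Complex.ofReal *ᵥ x
        = ((ω : ℂ) * Complex.I) • (Q.map Complex.ofReal *ᵥ x)) →
      (star x ⬝ᵥ (N.map Complex.ofReal *ᵥ x)).re < 0) :
    ∃ (P : Matrix (Fin n) (Fin n) ℝ) (τ : ℝ), P.IsSymm ∧ 0 ≤ τ ∧ ∀ x : Fin n → ℝ, x ≠ 0 →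
      (Q *ᵥ x) ⬝ᵥ (P *ᵥ ((Q * A) *ᵥ x)) + τ * (x ⬝ᵥ (N *ᵥ x)) < 0 := by
  set Qc : Matrix (Fin n) (Fin n) ℂ := Q.map Complex.ofReal with hQc
  set Gc : Matrix (Fin n) (Fin n) ℂ := (Q * A).map Complex.ofReal with hGc
  set Nc : Matrix (Fin n) (Fin n) ℂ := N.map Complex.ofReal with hNc
  let Φ : Matrix (Fin n) (Fin n) ℂ →ₗ[ℝ] Matrix (Fin n) (Fin n) ℂ × ℝ :=
    { toFun := fun Z => (Qc * Z * Gcᴴ + Gc * Z * Qcᴴ, (Nc * Z).trace.re)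
      map_add' := fun Z W => by
        ext1
        · simp only [Matrix.mul_add, Matrix.add_mul, Prod.fst_add]; abel
        · simp [Matrix.mul_add]
      map_smul' := fun s Z => by
        ext1
        · simp
        · simp }
  set K := Φ '' {Z | Z.PosSemidef ∧ Z.trace = 1} with hK
  have hKconv : Convex ℝ K := convex_setOf_posSemidef_trace_eq_one.linear_image Φ
  have hKcomp : IsCompact K := by
    rw [hK, ← image_mul_conjTranspose]
    have hΦ : Continuous Φ := Φ.continuous_of_finiteDimensional
    exact (isCompact_setOf_sum_norm_sq_eq_one.image (by fun_prop)).image hΦ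
  set L : Set (Matrix (Fin n) (Fin n) ℂ × ℝ) := {0} ×ˢ Set.Ici 0 with hL
  -- Write `Z = C Cᴴ` and apply the trace lemma to `f = Q C`, `g = Q A C`, `T = -Cᴴ N C`, with `k =
  -- C`: a point of the intersection would force trace `0`, hence `C = 0`, against trace one.
  have hdisj : Disjoint K L := by
    rw [Set.disjoint_left]
    rintro z hzK ⟨hz1, hz2⟩
    rw [hK, ← image_mul_conjTranspose] at hzK
    obtain ⟨_, ⟨C, hC, rfl⟩, rfl⟩ := hzK
    have hz1 : Qc * (C * Cᴴ) * Gcᴴ + Gc * (C * Cᴴ) * Qcᴴ = 0 := hz1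
    have hz2 : 0 ≤ (Nc * (C * Cᴴ)).trace.re := hz2
    have hC1 : ∑ i, ∑ j, ‖C i j‖ ^ 2 = 1 := hC
    have key := re_trace_nonneg_of_frequency (X := EuclideanSpace ℂ (Fin n))
      (Y := EuclideanSpace ℂ (Fin n)) _ (EuclideanSpace ℂ (Fin n))
      (toEuclideanLin (Qc * C)) (toEuclideanLin (Gc * C)) (toEuclideanLin (-(Cᴴ * Nc * C)))
      (toEuclideanLin C) rfl
    have htr : LinearMap.trace ℂ _ (toEuclideanLin (-(Cᴴ * Nc * C)))
        = -(Nc * (C * Cᴴ)).trace := by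
      rw [toEuclideanLin, toLpLin_eq_toLin, trace_toLin_eq, trace_neg, Matrix.mul_assoc, trace_mul_comm,
        Matrix.mul_assoc]
    obtain ⟨k1, k2⟩ := key (by
        rw [← toEuclideanLin_conjTranspose_eq_adjoint, ← toEuclideanLin_conjTranspose_eq_adjoint,
          ← toLpLin_mul_same, ← toLpLin_mul_same, ← map_add]
        simp only [conjTranspose_mul]
        rw [← map_zero (toEuclideanLin (𝕜 := ℂ) (m := Fin n) (n := Fin n)), ← hz1]
        simp only [Matrix.mul_assoc])
      (by
        intro w hw
        set x : Fin n → ℂ := C *ᵥ w.ofLp with hx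
        have hin : (inner ℂ w (toEuclideanLin (-(Cᴴ * Nc * C)) w)).re
            = -(star x ⬝ᵥ (Nc *ᵥ x)).re := by
          rw [EuclideanSpace.inner_eq_star_dotProduct, dotProduct_comm, hx, star_mulVec,
            ← dotProduct_mulVec]
          simp only [toLpLin_apply, neg_mulVec, mulVec_mulVec, Matrix.mul_assoc,
            dotProduct_neg, Complex.neg_re]
        have hk : toEuclideanLin C w = WithLp.toLp 2 x := rfl
        by_cases hx0 : x = 0
        · rw [hin, hk, hx0]; simp
        · have h1 := hfreq x hx0 (by
            rcases hw with h | ⟨ω, h⟩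
            · left
              have := congrArg WithLp.ofLp h
              simpa [toLpLin_apply, hx, mulVec_mulVec] using this
            · right
              refine ⟨ω, ?_⟩
              have := congrArg WithLp.ofLp h
              simpa [toLpLin_apply, hx, mulVec_mulVec] using this)
          rw [hin]
          exact ⟨by linarith, fun h => absurd h (by linarith)⟩)
    have k3 := k2 (by rw [htr, Complex.neg_re] at k1 ⊢; linarith)
    have k4 : C = 0 := by simpa using k3
    simp [k4] at hC1
  have : LocallyConvexSpace ℝ (Matrix (Fin n) (Fin n) ℂ) :=
    inferInstanceAs (LocallyConvexSpace ℝ (Fin n → Fin n → ℂ))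
  obtain ⟨φ, u, v, hu, huv, hv⟩ := geometric_hahn_banach_compact_closed hKconv hKcomp
    ((convex_singleton 0).prod (convex_Ici 0)) (isClosed_singleton.prod isClosed_Ici) hdisj
  have hv0 : v < 0 := by
    have h := hv 0 ⟨rfl, le_refl (0 : ℝ)⟩
    rwa [map_zero] at h
  set τ : ℝ := φ (0, 1) with hτ
  have hφr : ∀ r : ℝ, φ (0, r) = r * τ := by
    intro r
    have : ((0 : Matrix (Fin n) (Fin n) ℂ), r) = r • ((0 : Matrix (Fin n) (Fin n) ℂ), (1 : ℝ)) := by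
      simp
    rw [this, map_smul, smul_eq_mul]
  -- A negative `τ` would bring the functional down to `v` on the ray `{0} × [0, ∞)`.
  have hτ0 : 0 ≤ τ := by
    by_contra! h
    have h1 := hv (0, v / τ) ⟨rfl, (div_pos_of_neg_of_neg hv0 h).le⟩
    rw [hφr, div_mul_cancel₀ _ h.ne] at h1
    exact lt_irrefl _ h1
  set P₀ : Matrix (Fin n) (Fin n) ℝ := Matrix.of fun i j => φ (single i j 1, 0) with hP₀
  have hφM : ∀ a b : Fin n → ℝ,
      φ ((vecMulVec a b).map Complex.ofReal, 0) = a ⬝ᵥ (P₀ *ᵥ b) := by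
    intro a b
    have : ((vecMulVec a b).map Complex.ofReal, (0 : ℝ))
        = ∑ i, ∑ j, (a i * b j) • (single i j (1 : ℂ), (0 : ℝ)) := by
      ext1
      · simp only [Prod.fst_sum, Prod.smul_fst, smul_single, Complex.real_smul, mul_one]
        exact matrix_eq_sum_single _
      · simp [Prod.snd_sum]
    rw [this, map_sum]
    simp only [map_sum, map_smul, dotProduct, mulVec, Finset.mul_sum, hP₀, of_apply, smul_eq_mul]
    refine Finset.sum_congr rfl fun i _ => Finset.sum_congr rfl fun j _ => by ring
  -- The functional is tested on `x xᵀ / (x ⬝ x)` with `x` real, so only its values on real matrices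
  -- matter. The first component of `Φ` there is a sum of two mutually transposed rank-one matrices,
  -- hence the symmetrization.
  refine ⟨P₀ + P₀ᵀ, τ, by simp [IsSymm, add_comm], hτ0, fun x hx => ?_⟩
  have hs : 0 < x ⬝ᵥ x := by
    simpa using (dotProduct_star_self_pos_iff (v := x)).2 hx
  have hcast : ∀ a b : Fin n → ℝ, (vecMulVec a b).map Complex.ofReal
      = vecMulVec (fun i => (a i : ℂ)) (star fun i => (b i : ℂ)) := by
    intro a b
    ext i j
    simp [vecMulVec_apply]
  have hmul : ∀ (M : Matrix (Fin n) (Fin n) ℝ) (a : Fin n → ℝ),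
      M.map Complex.ofReal *ᵥ (fun i => (a i : ℂ)) = fun i => ((M *ᵥ a) i : ℂ) := by
    intro M a
    ext i
    simp [mulVec, dotProduct]
  have hmem : Φ ((x ⬝ᵥ x)⁻¹ • (vecMulVec x x).map Complex.ofReal) ∈ K := by
    refine ⟨_, ⟨?_, ?_⟩, rfl⟩
    · rw [hcast]
      have := (posSemidef_vecMulVec_self_star (fun i => (x i : ℂ))).smul
        (a := (((x ⬝ᵥ x)⁻¹ : ℝ) : ℂ)) (by exact_mod_cast (inv_pos.2 hs).le)
      exact this
    · rw [trace_smul, hcast, trace_vecMulVec]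
      have h1 : (fun i => (x i : ℂ)) ⬝ᵥ star (fun i => (x i : ℂ)) = ((x ⬝ᵥ x : ℝ) : ℂ) := by
        simp [dotProduct]
      rw [h1, Complex.real_smul, ← Complex.ofReal_mul, inv_mul_cancel₀ hs.ne', Complex.ofReal_one]
  have hval : Φ ((vecMulVec x x).map Complex.ofReal)
      = ((vecMulVec (Q *ᵥ x) ((Q * A) *ᵥ x)).map Complex.ofReal
          + (vecMulVec ((Q * A) *ᵥ x) (Q *ᵥ x)).map Complex.ofReal, x ⬝ᵥ (N *ᵥ x)) := by
    ext1
    · simp only [hcast]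
      change Qc * _ * Gcᴴ + Gc * _ * Qcᴴ = _
      rw [mul_vecMulVec, mul_vecMulVec, vecMulVec_mul, vecMulVec_mul, ← star_mulVec,
        ← star_mulVec, hQc, hGc, hmul, hmul]
    · change (Nc * _).trace.re = _
      rw [hcast, mul_vecMulVec, trace_vecMulVec, hNc, hmul]
      simp [dotProduct, mul_comm]
  have h1 := (hu _ hmem).trans (huv.trans hv0)
  rw [map_smul, map_smul, smul_eq_mul, hval] at h1
  have h2 := neg_of_mul_neg_right h1 (inv_pos.2 hs).le
  have h3 : φ ((vecMulVec (Q *ᵥ x) ((Q * A) *ᵥ x)).map Complex.ofReal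
          + (vecMulVec ((Q * A) *ᵥ x) (Q *ᵥ x)).map Complex.ofReal, x ⬝ᵥ (N *ᵥ x))
      = φ ((vecMulVec (Q *ᵥ x) ((Q * A) *ᵥ x)).map Complex.ofReal, 0)
        + φ ((vecMulVec ((Q * A) *ᵥ x) (Q *ᵥ x)).map Complex.ofReal, 0)
        + φ (0, x ⬝ᵥ (N *ᵥ x)) := by
    rw [← map_add, ← map_add]; simp
  rw [h3, hφM, hφM, hφr] at h2
  have h4 : ((Q * A) *ᵥ x) ⬝ᵥ (P₀ *ᵥ (Q *ᵥ x)) = (Q *ᵥ x) ⬝ᵥ (P₀ᵀ *ᵥ ((Q * A) *ᵥ x)) := by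
    rw [dotProduct_mulVec, dotProduct_comm, ← mulVec_transpose]
  rw [add_mulVec, dotProduct_add]
  linarith

end Separation

/-- Kalman-Yakubovich-Popov lemma for a strictly proper system of relative degree one, without
controllability or observability assumptions. -/
theorem exists_kyp_matrix (A : Matrix (Fin n) (Fin n) ℝ) (B c : Matrix (Fin n) (Fin m) ℝ)
    (μ ν : Fin m → ℝ) (hμ : ∀ i, 0 < μ i) (hν : ∀ i, ν i < 0)
    (hcB : cᵀ * B = diagonal μ) (hcAB : cᵀ * A * B = diagonal ν)
    (hfreq : ∀ (ω : ℝ) (x : Fin n → ℂ) (u : Fin m → ℂ), x ≠ 0 →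
      ((ω : ℂ) * Complex.I) • x - A.map Complex.ofReal *ᵥ x = B.map Complex.ofReal *ᵥ u →
        0 < (star ((c.map Complex.ofReal)ᵀ *ᵥ x) ⬝ᵥ u).re) :
    ∃ P : Matrix (Fin n) (Fin n) ℝ, P.IsSymm ∧ P * B = c ∧
      ∀ x : Fin n → ℝ, x ≠ 0 → x ⬝ᵥ (P *ᵥ (A *ᵥ x)) < 0 := by
  set a : Matrix (Fin m) (Fin m) ℝ := diagonal fun i => (μ i)⁻¹ with ha
  set Q : Matrix (Fin n) (Fin n) ℝ := 1 - B * a * cᵀ with hQ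
  set N : Matrix (Fin n) (Fin n) ℝ := c * a * cᵀ * A with hN
  have hacB : a * (cᵀ * B) = 1 := by
    rw [hcB, ha, diagonal_mul_diagonal]
    simp [(hμ _).ne']
  have hQB : Q * B = 0 := by
    rw [hQ, Matrix.sub_mul, Matrix.mul_assoc, Matrix.mul_assoc, hacB]; simp
  have hmap : ∀ {k l p : ℕ} (M : Matrix (Fin k) (Fin l) ℝ) (K : Matrix (Fin l) (Fin p) ℝ),
      (M * K).map Complex.ofReal = M.map Complex.ofReal * K.map Complex.ofReal :=
    fun M K => Matrix.map_mul (f := Complex.ofRealHom)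
  have hamap : a.map Complex.ofReal = diagonal fun i => (μ i : ℂ)⁻¹ := by
    rw [ha, diagonal_map Complex.ofReal_zero]; simp
  have hQmap : Q.map Complex.ofReal = 1 - B.map Complex.ofReal
      * (diagonal fun i => (μ i : ℂ)⁻¹) * (c.map Complex.ofReal)ᵀ := by
    rw [hQ, Matrix.map_sub _ Complex.ofReal_sub, hmap, hmap, hamap, transpose_map,
      Matrix.map_one _ Complex.ofReal_zero Complex.ofReal_one]
  obtain ⟨P, τ, hPs, hτ, hP⟩ := exists_separating_form Q A N (by
    intro x hx h
    have hNmap : N.map Complex.ofReal = c.map Complex.ofReal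
        * (diagonal fun i => (μ i : ℂ)⁻¹) * (c.map Complex.ofReal)ᵀ * A.map Complex.ofReal := by
      rw [hN, hmap, hmap, hmap, hamap, transpose_map]
    rw [hmap, hQmap] at h
    rw [hNmap]
    refine re_cost_neg_of_frequency (A.map Complex.ofReal) (B.map Complex.ofReal)
      (c.map Complex.ofReal) ?_ μ ν hμ hν ?_ hfreq x hx h
    · ext i j; simp
    · rw [← transpose_map, ← hmap, ← hmap, hcAB, diagonal_map Complex.ofReal_zero])
  -- `Q B = 0` and `a cᵀ B = 1` give `R B = τ c`, so dividing by `τ` yields the required matrix.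
  set R : Matrix (Fin n) (Fin n) ℝ := Qᵀ * P * Q + τ • (c * a * cᵀ) with hR
  have hRs : R.IsSymm := by
    rw [IsSymm, hR, transpose_add, transpose_mul, transpose_mul, transpose_smul, transpose_mul,
      transpose_mul, transpose_transpose, transpose_transpose, hPs.eq, ha, diagonal_transpose]
    simp only [Matrix.mul_assoc]
  have hRB : R * B = τ • c := by
    rw [hR, Matrix.add_mul, Matrix.mul_assoc, hQB, Matrix.smul_mul, Matrix.mul_assoc,
      Matrix.mul_assoc, Matrix.mul_assoc, hacB]
    simp
  have hRneg : ∀ x : Fin n → ℝ, x ≠ 0 → x ⬝ᵥ (R *ᵥ (A *ᵥ x)) < 0 := by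
    intro x hx
    have h1 := hP x hx
    have h2 : x ⬝ᵥ (R *ᵥ (A *ᵥ x)) = (Q *ᵥ x) ⬝ᵥ (P *ᵥ ((Q * A) *ᵥ x)) + τ * (x ⬝ᵥ (N *ᵥ x)) := by
      rw [hR, add_mulVec, dotProduct_add, smul_mulVec, dotProduct_smul, smul_eq_mul, mulVec_mulVec,
        mulVec_mulVec _ _ A, ← hN, Matrix.mul_assoc, Matrix.mul_assoc, ← mulVec_mulVec,
        dotProduct_mulVec, vecMul_transpose, mulVec_mulVec]
    rw [h2]; exact h1
  -- `τ = 0` is possible only without inputs: the vector `B eᵢ` is killed by `Q`, so the strict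
  -- inequality would read `0 < 0`.
  rcases hτ.eq_or_lt with h0 | hpos
  · refine ⟨R, hRs, ?_, hRneg⟩
    have hm : IsEmpty (Fin m) := by
      refine ⟨fun i => ?_⟩
      have hBi : B *ᵥ Pi.single i 1 ≠ 0 := by
        intro h
        have h1 : (cᵀ * B) *ᵥ Pi.single i 1 = 0 := by rw [← mulVec_mulVec, h, mulVec_zero]
        rw [hcB] at h1
        have := congrFun h1 i
        simp at this
        exact (hμ i).ne' this
      have h1 := hP _ hBi
      rw [mulVec_mulVec, hQB, ← h0, zero_mulVec, zero_dotProduct, zero_mul, add_zero] at h1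
      exact lt_irrefl _ h1
    ext _ j
    exact (hm.false j).elim
  · refine ⟨τ⁻¹ • R, ?_, ?_, fun x hx => ?_⟩
    · rw [IsSymm, transpose_smul, hRs.eq]
    · rw [Matrix.smul_mul, hRB, smul_smul, inv_mul_cancel₀ hpos.ne', one_smul]
    · rw [smul_mulVec, dotProduct_smul, smul_eq_mul]
      exact mul_neg_of_pos_of_neg (inv_pos.2 hpos) (hRneg x hx)

end KYP

/-! ### Hurwitz matrices and positive definiteness of Lyapunov solutions -/

section Lyapunov

variable {n : ℕ}

section PowTendsto

attribute [local instance] Matrix.linftyOpNormedRing Matrix.linftyOpNormedAlgebra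

/-- Gelfand's formula: eventually `‖M ^ k‖ ≤ r ^ k` for some `r < 1` above the spectral radius. -/
theorem tendsto_pow_of_eigenvalues_norm_lt_one (M : Matrix (Fin n) (Fin n) ℂ)
    (h : ∀ (z : ℂ) (v : Fin n → ℂ), M *ᵥ v = z • v → 1 ≤ ‖z‖ → v = 0) :
    Tendsto (fun k : ℕ => M ^ k) atTop (𝓝 0) := by
  rcases isEmpty_or_nonempty (Fin n) with hn | hn
  · have : (fun k : ℕ => M ^ k) = fun _ => 0 := by
      ext k i; exact (hn.false i).elim
    rw [this]; exact tendsto_const_nhds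
  have hlt : spectralRadius ℂ M < (1 : NNReal) := by
    refine spectrum.spectralRadius_lt_of_forall_lt M fun z hz => ?_
    by_contra! hz1
    rw [← Matrix.spectrum_toLin', ← Module.End.hasEigenvalue_iff_mem_spectrum] at hz
    obtain ⟨v, hv⟩ := hz.exists_hasEigenvector
    exact hv.2 (h z v (by simpa using hv.apply_eq_smul) hz1)
  obtain ⟨r, hr1, hr2⟩ := ENNReal.lt_iff_exists_nnreal_btwn.1 hlt
  have hr2 : r < 1 := by exact_mod_cast hr2
  have h1 := (spectrum.pow_nnnorm_pow_one_div_tendsto_nhds_spectralRadius M).eventually_lt_const hr1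
  refine tendsto_zero_iff_norm_tendsto_zero.2 ?_
  refine squeeze_zero' (Eventually.of_forall fun _ => norm_nonneg _) ?_
    (tendsto_pow_atTop_nhds_zero_of_lt_one r.2 (by exact_mod_cast hr2))
  filter_upwards [h1, eventually_gt_atTop 0] with k hk hk0
  have hk0' : (0 : ℝ) < k := by exact_mod_cast hk0
  have h2 := ENNReal.rpow_le_rpow hk.le hk0'.le
  rw [← ENNReal.rpow_mul, one_div_mul_cancel hk0'.ne', ENNReal.rpow_one, ENNReal.rpow_natCast] at h2
  have h3 : ‖M ^ k‖₊ ≤ r ^ k := by exact_mod_cast h2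
  exact_mod_cast h3

end PowTendsto

/-- No eigenvalue in the closed right half-plane. -/
def IsHurwitz (A : Matrix (Fin n) (Fin n) ℝ) : Prop :=
  ∀ (z : ℂ) (v : Fin n → ℂ), 0 ≤ z.re → A.map Complex.ofReal *ᵥ v = z • v → v = 0

theorem IsHurwitz.isUnit_one_sub {A : Matrix (Fin n) (Fin n) ℝ} (hA : IsHurwitz A) :
    IsUnit (1 - A) := by
  rw [← Matrix.mulVec_injective_iff_isUnit, ← coe_mulVecLin, injective_iff_map_eq_zero]
  intro v hv
  have h1 : A *ᵥ v = v := by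
    simp only [coe_mulVecLin, sub_mulVec, one_mulVec] at hv
    exact (sub_eq_zero.1 hv).symm
  have h2 := hA 1 (fun i => (v i : ℂ)) (by simp) (by
    ext i
    have := congrFun h1 i
    simp only [mulVec, dotProduct, map_apply, one_smul] at this ⊢
    exact_mod_cast congrArg Complex.ofReal this)
  ext i
  have := congrFun h2 i
  simpa using this

/-- The Cayley transform carries the open left half-plane into the open unit disc: an eigenvalue `z`
of the transform comes from the eigenvalue `(z - 1)/(z + 1)` of `A`, whose real part is nonnegative
when `|z| ≥ 1`. -/
theorem IsHurwitz.tendsto_cayley_pow {A : Matrix (Fin n) (Fin n) ℝ} (hA : IsHurwitz A) :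
    Tendsto (fun k : ℕ => ((1 + A) * (1 - A)⁻¹) ^ k) atTop (𝓝 0) := by
  have hu := (isUnit_iff_isUnit_det _).1 hA.isUnit_one_sub
  set M := (1 + A) * (1 - A)⁻¹ with hM
  have hMA : M * (1 - A) = 1 + A := by rw [hM, Matrix.mul_assoc, nonsing_inv_mul _ hu, mul_one]
  have e1 : (1 - A).map Complex.ofReal = 1 - A.map Complex.ofReal := by
    rw [Matrix.map_sub _ Complex.ofReal_sub, Matrix.map_one _ Complex.ofReal_zero Complex.ofReal_one]
  have e2 : (1 + A).map Complex.ofReal = 1 + A.map Complex.ofReal := by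
    rw [Matrix.map_add _ Complex.ofReal_add, Matrix.map_one _ Complex.ofReal_zero Complex.ofReal_one]
  have hmap : M.map Complex.ofReal * (1 - A.map Complex.ofReal) = 1 + A.map Complex.ofReal := by
    have := congrArg (Complex.ofRealHom.mapMatrix (m := Fin n)) hMA
    rw [map_mul] at this
    rw [← e1, ← e2]
    exact this
  have hmap' : (1 - A.map Complex.ofReal) * ((1 - A)⁻¹).map Complex.ofReal = 1 := by
    have := congrArg (Complex.ofRealHom.mapMatrix (m := Fin n)) (mul_nonsing_inv _ hu)
    rw [map_mul, map_one] at this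
    rw [← e1]
    exact this
  have key : Tendsto (fun k : ℕ => (M.map Complex.ofReal) ^ k) atTop (𝓝 0) := by
    refine tendsto_pow_of_eigenvalues_norm_lt_one _ fun z v hv hz => ?_
    set w := ((1 - A)⁻¹).map Complex.ofReal *ᵥ v with hw
    have hvw : v = w - A.map Complex.ofReal *ᵥ w := by
      have : v = (1 - A.map Complex.ofReal) *ᵥ w := by rw [hw, mulVec_mulVec, hmap', one_mulVec]
      rwa [sub_mulVec, one_mulVec] at this
    have h1 : w + A.map Complex.ofReal *ᵥ w = z • (w - A.map Complex.ofReal *ᵥ w) := by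
      rw [← hvw, ← hv]
      conv_rhs => rw [hvw]
      have := congrArg (· *ᵥ w) hmap
      simp only [← mulVec_mulVec, sub_mulVec, add_mulVec, one_mulVec] at this
      exact this.symm
    have h2 : (z + 1) • (A.map Complex.ofReal *ᵥ w) = (z - 1) • w := by
      rw [smul_sub] at h1
      rw [add_smul, sub_smul, one_smul, one_smul, ← sub_eq_zero] at *
      rw [← h1]; abel_nf
    have hw0 : w = 0 := by
      by_cases hz1 : z + 1 = 0
      · rw [hz1, zero_smul] at h2
        have : z - 1 = -2 := by linear_combination hz1
        rw [this] at h2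
        simpa using h2.symm
      · refine hA ((z - 1) / (z + 1)) w ?_ ?_
        · rw [Complex.div_re, ← add_div]
          refine div_nonneg ?_ (Complex.normSq_nonneg _)
          have h3 : 1 ≤ Complex.normSq z := by
            rw [Complex.normSq_eq_norm_sq]; nlinarith
          rw [Complex.normSq_apply] at h3
          simp
          nlinarith
        · rw [div_eq_inv_mul, mul_smul, ← h2, smul_smul, inv_mul_cancel₀ hz1, one_smul]
    rw [hvw, hw0]; simp
  refine tendsto_pi_nhds.2 fun i => tendsto_pi_nhds.2 fun j => ?_
  have h1 := (tendsto_pi_nhds.1 ((tendsto_pi_nhds.1 key) i)) j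
  have h2 := (Complex.continuous_re.tendsto _).comp h1
  refine h2.congr fun k => ?_
  have : (M.map Complex.ofReal) ^ k = (M ^ k).map Complex.ofReal :=
    (map_pow (Complex.ofRealHom.mapMatrix (m := Fin n)) M k).symm
  simp [this]

/-- Discrete-time argument for `V x = x ⬝ P x`: since `V (z + A z) - V (z - A z) = 4 z ⬝ P A z`, `V`
strictly decreases along the Cayley transform, whose powers tend to `0`. Hence `V ≥ 0`, and `V x > V
(M x) ≥ 0` for `x ≠ 0`. -/
theorem IsHurwitz.posDef_of_lyapunov {A P : Matrix (Fin n) (Fin n) ℝ} (hA : IsHurwitz A)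
    (hP : P.IsSymm) (hneg : ∀ x : Fin n → ℝ, x ≠ 0 → x ⬝ᵥ (P *ᵥ (A *ᵥ x)) < 0) : P.PosDef := by
  have hu := (isUnit_iff_isUnit_det _).1 hA.isUnit_one_sub
  set M := (1 + A) * (1 - A)⁻¹ with hM
  have hsymm : ∀ x y : Fin n → ℝ, x ⬝ᵥ (P *ᵥ y) = y ⬝ᵥ (P *ᵥ x) := by
    intro x y
    rw [dotProduct_mulVec, ← mulVec_transpose, hP.eq, dotProduct_comm]
  have hdec : ∀ x : Fin n → ℝ, x ≠ 0 → (M *ᵥ x) ⬝ᵥ (P *ᵥ (M *ᵥ x)) < x ⬝ᵥ (P *ᵥ x) := by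
    intro x hx
    set z := (1 - A)⁻¹ *ᵥ x with hz
    have hxz : x = z - A *ᵥ z := by
      have : x = (1 - A) *ᵥ z := by rw [hz, mulVec_mulVec, mul_nonsing_inv _ hu, one_mulVec]
      rwa [sub_mulVec, one_mulVec] at this
    have hz0 : z ≠ 0 := by
      intro h; rw [h] at hxz; simp at hxz; exact hx hxz
    have hMx : M *ᵥ x = z + A *ᵥ z := by
      rw [hM, ← mulVec_mulVec, ← hz, add_mulVec, one_mulVec]
    have h1 := hneg z hz0
    rw [hMx, hxz]
    simp only [mulVec_add, mulVec_sub, dotProduct_add, add_dotProduct, dotProduct_sub,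
      sub_dotProduct]
    rw [hsymm (A *ᵥ z) z]
    linarith
  have hle : ∀ x : Fin n → ℝ, (M *ᵥ x) ⬝ᵥ (P *ᵥ (M *ᵥ x)) ≤ x ⬝ᵥ (P *ᵥ x) := by
    intro x
    rcases eq_or_ne x 0 with rfl | hx
    · simp
    · exact (hdec x hx).le
  have hnonneg : ∀ x : Fin n → ℝ, 0 ≤ x ⬝ᵥ (P *ᵥ x) := by
    intro x
    have hanti : Antitone fun k : ℕ => (M ^ k *ᵥ x) ⬝ᵥ (P *ᵥ (M ^ k *ᵥ x)) := by
      refine antitone_nat_of_succ_le fun k => ?_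
      have := hle (M ^ k *ᵥ x)
      rwa [mulVec_mulVec, ← pow_succ'] at this
    have hlim : Tendsto (fun k : ℕ => (M ^ k *ᵥ x) ⬝ᵥ (P *ᵥ (M ^ k *ᵥ x))) atTop (𝓝 0) := by
      have hcont : Continuous fun N : Matrix (Fin n) (Fin n) ℝ => (N *ᵥ x) ⬝ᵥ (P *ᵥ (N *ᵥ x)) := by
        fun_prop
      have := (hcont.tendsto 0).comp hA.tendsto_cayley_pow
      rw [zero_mulVec, zero_dotProduct] at this
      exact this
    have := hanti.le_of_tendsto hlim 0
    simpa using this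
  refine Matrix.PosDef.of_dotProduct_mulVec_pos 
    (by rw [IsHermitian, conjTranspose_eq_transpose_of_trivial, hP.eq]) fun x hx => ?_
  rw [star_trivial]
  exact (hnonneg _).trans_lt (hdec x hx)

end Lyapunov

/-! ### State space: evaluation of the transfer matrix and absence of hidden unstable modes -/

namespace StateSpace

open Polynomial

variable {n m : ℕ} (R : StateSpace n m)

/-- `A` over the complex numbers. -/
abbrev Ac : Matrix (Fin n) (Fin n) ℂ := R.A.map Complex.ofReal

/-- `B` over the complex numbers. -/
abbrev Bc : Matrix (Fin n) (Fin m) ℂ := R.B.map Complex.ofReal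

/-- `c` over the complex numbers. -/
abbrev cc : Matrix (Fin n) (Fin m) ℂ := R.c.map Complex.ofReal

/-- The pencil `s I - A`. -/
def pencil (s : ℂ) : Matrix (Fin n) (Fin n) ℂ := scalar (Fin n) s - R.Ac

theorem pencil_mulVec (s : ℂ) (v : Fin n → ℂ) : R.pencil s *ᵥ v = s • v - R.Ac *ᵥ v := by
  rw [pencil, sub_mulVec, scalar_apply, ← smul_one_eq_diagonal, smul_mulVec, one_mulVec]

theorem charmatrix_map_aeval (s : ℂ) :
    (charmatrix R.A).map (aeval s) = R.pencil s := by
  ext i j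
  rw [pencil]
  rcases eq_or_ne i j with rfl | h
  · simp [charmatrix_apply_eq]
  · simp [h]

theorem aeval_charpoly (s : ℂ) : aeval s R.A.charpoly = (R.pencil s).det := by
  rw [charpoly, ← charmatrix_map_aeval]
  exact RingHom.map_det (aeval s : ℝ[X] →ₐ[ℝ] ℂ).toRingHom _

/-- Numerator of the transfer matrix over the common denominator `charpoly A`. -/
def transferNum : Matrix (Fin m) (Fin m) ℝ[X] :=
  R.cᵀ.map Polynomial.C * (charmatrix R.A).adjugate * R.B.map Polynomial.C

theorem charpoly_smul_transfer :
    algebraMap ℝ[X] (RatFunc ℝ) R.A.charpoly • R.transfer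
      = R.transferNum.map (algebraMap ℝ[X] (RatFunc ℝ)) := by
  set K := algebraMap ℝ[X] (RatFunc ℝ) with hK
  have hmat : sId n - R.A.map RatFunc.C = (charmatrix R.A).map K := by
    ext i j
    rw [sId]
    rcases eq_or_ne i j with rfl | h
    · simp [charmatrix_apply_eq, hK]
    · simp [h, hK]
  have hdet : ((charmatrix R.A).map K).det = K R.A.charpoly := (RingHom.map_det K _).symm
  have hχ : K R.A.charpoly ≠ 0 := RatFunc.algebraMap_ne_zero (charpoly_monic R.A).ne_zero
  have hadj : ((charmatrix R.A).map K).adjugate = (charmatrix R.A).adjugate.map K :=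
    (RingHom.map_adjugate K _).symm
  have hC : ∀ {a b : ℕ} (M : Matrix (Fin a) (Fin b) ℝ), M.map RatFunc.C = (M.map Polynomial.C).map K := by
    intro a b M; ext i j; simp [hK]
  rw [transfer, hmat, inv_def, hdet, hadj, Ring.inverse_eq_inv', Matrix.mul_smul, Matrix.smul_mul,
    smul_smul, mul_inv_cancel₀ hχ, one_smul, hC, hC, transferNum, ← Matrix.map_mul, ← Matrix.map_mul]

theorem transferNum_map_aeval (s : ℂ) :
    R.transferNum.map (aeval s) = R.ccᵀ * (R.pencil s).adjugate * R.Bc := by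
  have hadj : ((charmatrix R.A).map (aeval s)).adjugate = (charmatrix R.A).adjugate.map (aeval s) :=
    (RingHom.map_adjugate (aeval s : ℝ[X] →ₐ[ℝ] ℂ).toRingHom _).symm
  have hC : ∀ {a b : ℕ} (M : Matrix (Fin a) (Fin b) ℝ),
      (M.map Polynomial.C).map (aeval s) = M.map Complex.ofReal := by
    intro a b M; ext i j; simp
  rw [transferNum, Matrix.map_mul, Matrix.map_mul, hC, hC, ← hadj, charmatrix_map_aeval]
  rfl

section DiagonalTransfer

variable {R} {N D : Fin m → ℝ[X]}

/-- The identity in `ℝ(s)` is cleared of denominators before evaluation, using the common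
denominator `charpoly A`. -/
theorem transfer_eval_of_diagonal
    (h : R.transfer = diagonal fun i => algebraMap ℝ[X] (RatFunc ℝ) (N i)
      / algebraMap ℝ[X] (RatFunc ℝ) (D i)) {s : ℂ} (hs : ∀ i, aeval s (D i) ≠ 0)
    (hdet : (R.pencil s).det ≠ 0) :
    R.ccᵀ * (R.pencil s)⁻¹ * R.Bc = diagonal fun i => aeval s (N i) / aeval s (D i) := by
  have hD : ∀ i, D i ≠ 0 := by
    intro i h0; apply hs i; rw [h0, map_zero]
  have hpoly : ∀ i j, D i * R.transferNum i j
      = R.A.charpoly * (diagonal N : Matrix (Fin m) (Fin m) ℝ[X]) i j := by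
    intro i j
    have hKD : algebraMap ℝ[X] (RatFunc ℝ) (D i) ≠ 0 := RatFunc.algebraMap_ne_zero (hD i)
    have h1 := congrFun (congrFun R.charpoly_smul_transfer i) j
    rw [Matrix.smul_apply, map_apply, h, smul_eq_mul] at h1
    apply RatFunc.algebraMap_injective ℝ
    rw [map_mul, map_mul, ← h1]
    rcases eq_or_ne i j with rfl | hij
    · rw [diagonal_apply_eq, diagonal_apply_eq]
      field_simp
    · rw [diagonal_apply_ne _ hij, diagonal_apply_ne _ hij]; simp
  have hev : R.ccᵀ * (R.pencil s).adjugate * R.Bc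
      = (R.pencil s).det • diagonal fun i => aeval s (N i) / aeval s (D i) := by
    rw [← transferNum_map_aeval, ← aeval_charpoly]
    ext i j
    have h1 := congrArg (aeval s) (hpoly i j)
    rw [map_mul, map_mul] at h1
    rw [map_apply, Matrix.smul_apply, smul_eq_mul, ← mul_right_inj' (hs i), h1]
    rcases eq_or_ne i j with rfl | hij
    · rw [diagonal_apply_eq, diagonal_apply_eq]
      field_simp [hs i]
    · rw [diagonal_apply_ne _ hij, diagonal_apply_ne _ hij]; simp
  rw [inv_def, Ring.inverse_eq_inv', Matrix.mul_smul, Matrix.smul_mul, hev, smul_smul,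
    inv_mul_cancel₀ hdet, one_smul]

end DiagonalTransfer

theorem exists_left_inverse_of_mulVec {ι κ : Type*} [Fintype ι] [Fintype κ] [DecidableEq ι]
    [DecidableEq κ] (M : Matrix ι κ ℂ) (h : ∀ v, M *ᵥ v = 0 → v = 0) :
    ∃ N : Matrix κ ι ℂ, N * M = 1 := by
  obtain ⟨g, hg⟩ := (toLin' M).exists_leftInverse_of_injective
    (LinearMap.ker_eq_bot'.2 fun v hv => h v (by simpa using hv))
  refine ⟨LinearMap.toMatrix' g, ?_⟩
  have := congrArg LinearMap.toMatrix' hg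
  rwa [LinearMap.toMatrix'_comp, LinearMap.toMatrix'_toLin', LinearMap.toMatrix'_id] at this

theorem IsDetectable.exists_left_inverse {R : StateSpace n m} (h : R.IsDetectable) {z : ℂ}
    (hz : 0 ≤ z.re) :
    ∃ (X : Matrix (Fin n) (Fin n) ℂ) (Y : Matrix (Fin n) (Fin m) ℂ),
      X * R.pencil z + Y * R.ccᵀ = 1 := by
  obtain ⟨N, hN⟩ := exists_left_inverse_of_mulVec (fromRows (R.pencil z) R.ccᵀ) (by
    intro v hv
    rw [fromRows_mulVec] at hv
    have h1 : R.pencil z *ᵥ v = 0 := by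
      ext i; exact congrFun hv (Sum.inl i)
    have h2 : R.ccᵀ *ᵥ v = 0 := by
      ext i; exact congrFun hv (Sum.inr i)
    rw [pencil_mulVec, sub_eq_zero] at h1
    exact h z v hz h1.symm (by rw [transpose_map]; exact h2))
  refine ⟨N.toCols₁, N.toCols₂, ?_⟩
  rw [← fromCols_mul_fromRows, fromCols_toCols, hN]

theorem IsStabilizable.exists_right_inverse {R : StateSpace n m} (h : R.IsStabilizable) {z : ℂ}
    (hz : 0 ≤ z.re) :
    ∃ (X : Matrix (Fin n) (Fin n) ℂ) (Y : Matrix (Fin m) (Fin n) ℂ),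
      R.pencil z * X + R.Bc * Y = 1 := by
  obtain ⟨N, hN⟩ := exists_left_inverse_of_mulVec (fromRows (R.pencil z)ᵀ R.Bcᵀ) (by
    intro v hv
    rw [fromRows_mulVec] at hv
    have h1 : v ᵥ* R.pencil z = 0 := by
      ext i; rw [← mulVec_transpose]; exact congrFun hv (Sum.inl i)
    have h2 : v ᵥ* R.Bc = 0 := by
      ext i; rw [← mulVec_transpose]; exact congrFun hv (Sum.inr i)
    rw [pencil, vecMul_sub, scalar_apply, ← smul_one_eq_diagonal, vecMul_smul, vecMul_one,
      sub_eq_zero] at h1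
    exact h z v hz h1.symm h2)
  refine ⟨N.toCols₁ᵀ, N.toCols₂ᵀ, ?_⟩
  have := congrArg transpose hN
  rw [← fromCols_toCols N, fromCols_mul_fromRows] at this
  simpa [transpose_add, transpose_mul] using this

theorem eventually_det_pencil_ne_zero (z : ℂ) : ∀ᶠ s in 𝓝[≠] z, (R.pencil s).det ≠ 0 := by
  have hfin : {s : ℂ | (R.pencil s).det = 0}.Finite := by
    refine (((R.A.charpoly).map (algebraMap ℝ ℂ)).rootSet_finite ℂ).subset fun s hs => ?_
    rw [mem_rootSet]
    refine ⟨(Polynomial.map_ne_zero_iff (algebraMap ℝ ℂ).injective).2 (charpoly_monic R.A).ne_zero, ?_⟩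
    rw [aeval_map_algebraMap, aeval_charpoly]
    exact hs
  have := (hfin.subset (Set.sdiff_subset (t := {z}))).isClosed.isOpen_compl.mem_nhds
    (x := z) (by simp)
  filter_upwards [nhdsWithin_le_nhds this, self_mem_nhdsWithin] with s hs hsz h
  exact hs ⟨h, hsz⟩

/-- The Hautus conditions give Bezout identities at `z`. They express the resolvent, multiplied by
factors tending to the identity, through the transfer matrix alone, so the resolvent cannot blow up
where the transfer matrix has no pole. -/
theorem isHurwitz_of_diagonal_transfer {R : StateSpace n m} {N D : Fin m → ℝ[X]}
    (h : R.transfer = diagonal fun i => algebraMap ℝ[X] (RatFunc ℝ) (N i)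
      / algebraMap ℝ[X] (RatFunc ℝ) (D i)) (hD : ∀ i (s : ℂ), 0 ≤ s.re → aeval s (D i) ≠ 0)
    (hstab : R.IsStabilizable) (hdet : R.IsDetectable) : IsHurwitz R.A := by
  intro z v hz hv
  by_contra hv0
  have hdetz : (R.pencil z).det = 0 := by
    refine exists_mulVec_eq_zero_iff.1 ⟨v, hv0, ?_⟩
    rw [pencil_mulVec, sub_eq_zero]; exact hv.symm
  obtain ⟨X, Y, hXY⟩ := hstab.exists_right_inverse hz
  obtain ⟨X', Y', hXY'⟩ := hdet.exists_left_inverse hz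
  set w : ℂ → Matrix (Fin m) (Fin m) ℂ := fun s => diagonal fun i => aeval s (N i) / aeval s (D i)
    with hw
  set F : ℂ → Matrix (Fin n) (Fin n) ℂ := fun s =>
    (1 + (s - z) • X') * X + X' * R.Bc * Y + Y' * w s * Y with hF
  have hcont : ContinuousAt (fun s => (R.pencil s).det * (F s).det) z := by
    have hwc : ContinuousAt w z := by
      refine continuousAt_pi.2 fun i => continuousAt_pi.2 fun j => ?_
      rcases eq_or_ne i j with rfl | hij
      · simp only [hw, diagonal_apply_eq]
        exact ((N i).continuous_aeval.continuousAt).div ((D i).continuous_aeval.continuousAt) (hD i z hz)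
      · simp only [hw, diagonal_apply_ne _ hij]
        exact continuousAt_const
    have hFc : ContinuousAt F z := by
      have h1 : ContinuousAt (fun s : ℂ => (1 + (s - z) • X') * X + X' * R.Bc * Y) z := by fun_prop
      have hc : Continuous fun M : Matrix (Fin m) (Fin m) ℂ => Y' * M * Y := by fun_prop
      exact h1.add (hc.continuousAt.comp hwc)
    have hdetc : Continuous fun M : Matrix (Fin n) (Fin n) ℂ => M.det := by fun_prop
    have hp : Continuous fun s : ℂ => R.pencil s := by
      simp only [pencil, scalar_apply, ← smul_one_eq_diagonal]; fun_prop
    exact (hdetc.comp hp).continuousAt.mul (hdetc.continuousAt.comp hFc)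
  have hcont1 : Continuous fun s : ℂ => (1 + (s - z) • X').det * (1 + (s - z) • X).det := by
    fun_prop
  have hDev : ∀ᶠ s in 𝓝[≠] z, ∀ i, aeval s (D i) ≠ 0 := by
    refine nhdsWithin_le_nhds (eventually_all.2 fun i => ?_)
    exact ((D i).continuous_aeval.continuousAt).eventually_ne (hD i z hz)
  have heq : ∀ᶠ s in 𝓝[≠] z, (1 + (s - z) • X').det * (1 + (s - z) • X).det
      = (R.pencil s).det * (F s).det := by
    filter_upwards [R.eventually_det_pencil_ne_zero z, hDev] with s hs hsD
    have hu : IsUnit (R.pencil s).det := isUnit_iff_ne_zero.2 hs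
    have hpen : R.pencil s = R.pencil z + (s - z) • 1 := by
      simp only [pencil, scalar_apply, ← smul_one_eq_diagonal, sub_smul]; abel
    have e1 : 1 + (s - z) • X = R.pencil s * X + R.Bc * Y := by
      rw [← hXY, hpen, Matrix.add_mul, Matrix.smul_mul, one_mul]; abel
    have e2 : 1 + (s - z) • X' = X' * R.pencil s + Y' * R.ccᵀ := by
      rw [← hXY', hpen, Matrix.mul_add, Matrix.mul_smul, mul_one]; abel
    have e3 : (R.pencil s)⁻¹ * (1 + (s - z) • X) = X + (R.pencil s)⁻¹ * R.Bc * Y := by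
      rw [e1, Matrix.mul_add, nonsing_inv_mul_cancel_left _ _ hu, Matrix.mul_assoc]
    have e4 : (1 + (s - z) • X') * (R.pencil s)⁻¹ = X' + Y' * R.ccᵀ * (R.pencil s)⁻¹ := by
      rw [e2, Matrix.add_mul, mul_nonsing_inv_cancel_right _ _ hu]
    have e5 : (1 + (s - z) • X') * (R.pencil s)⁻¹ * (1 + (s - z) • X) = F s := by
      rw [Matrix.mul_assoc, e3, Matrix.mul_add, hF]
      simp only [hw]
      rw [← transfer_eval_of_diagonal h hsD hs]
      have : (1 + (s - z) • X') * ((R.pencil s)⁻¹ * R.Bc * Y)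
          = (X' + Y' * R.ccᵀ * (R.pencil s)⁻¹) * R.Bc * Y := by
        rw [← e4]; simp only [Matrix.mul_assoc]
      rw [this]
      simp only [Matrix.add_mul, Matrix.mul_assoc]
      abel
    rw [← e5, det_mul, det_mul, det_nonsing_inv, Ring.inverse_eq_inv']
    field_simp
  -- As `s → z` the left side tends to `1`, the right side to `det (pencil z) * det (F z) = 0`.
  have hlim := tendsto_nhds_unique
    ((hcont1.continuousAt.tendsto (x := z)).mono_left nhdsWithin_le_nhds |>.congr' heq)
    (hcont.tendsto.mono_left nhdsWithin_le_nhds)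
  rw [hdetz] at hlim
  simp at hlim

end StateSpace

/-! ### Frequency response, Markov parameters, and the KYP matrix of `W_w` -/

namespace StateSpace

open Polynomial

variable {n m : ℕ} (R : StateSpace n m)

variable {R} in
theorem det_pencil_ne_zero_of_isHurwitz (hA : IsHurwitz R.A) {s : ℂ} (hs : 0 ≤ s.re) :
    (R.pencil s).det ≠ 0 := by
  intro h0
  obtain ⟨v, hv0, hv⟩ := exists_mulVec_eq_zero_iff.2 h0
  rw [pencil_mulVec, sub_eq_zero] at hv
  exact hv0 (hA s v hs hv.symm)

variable {R} in
/-- If the channels have positive real part on the imaginary axis, so has the response to any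
nonzero sinusoidal motion. -/
theorem re_response_pos {N D : Fin m → ℝ[X]}
    (h : R.transfer = diagonal fun i => algebraMap ℝ[X] (RatFunc ℝ) (N i)
      / algebraMap ℝ[X] (RatFunc ℝ) (D i)) (hA : IsHurwitz R.A) {s : ℂ} (hs : 0 ≤ s.re)
    (hD : ∀ i, aeval s (D i) ≠ 0) (hpos : ∀ i, 0 < (aeval s (N i) / aeval s (D i)).re)
    {x : Fin n → ℂ} {u : Fin m → ℂ} (hx : x ≠ 0)
    (hxu : s • x - R.Ac *ᵥ x = R.Bc *ᵥ u) : 0 < (star (R.ccᵀ *ᵥ x) ⬝ᵥ u).re := by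
  have hdet := det_pencil_ne_zero_of_isHurwitz hA hs
  have hu : IsUnit (R.pencil s).det := isUnit_iff_ne_zero.2 hdet
  rw [← pencil_mulVec] at hxu
  have hx' : x = (R.pencil s)⁻¹ *ᵥ (R.Bc *ᵥ u) := by
    rw [← hxu, mulVec_mulVec, nonsing_inv_mul _ hu, one_mulVec]
  have hy : R.ccᵀ *ᵥ x = fun i => (aeval s (N i) / aeval s (D i)) * u i := by
    rw [hx', mulVec_mulVec, mulVec_mulVec, transfer_eval_of_diagonal h hD hdet]
    ext i
    rw [mulVec_diagonal]
  have hu0 : u ≠ 0 := by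
    rintro rfl
    rw [mulVec_zero, mulVec_zero] at hx'
    exact hx hx'
  have hterm : ∀ i, (star (R.ccᵀ *ᵥ x) i * u i).re
      = (aeval s (N i) / aeval s (D i)).re * Complex.normSq (u i) := by
    intro i
    rw [hy, Pi.star_apply, star_mul', Complex.star_def, mul_assoc,
      ← Complex.normSq_eq_conj_mul_self, Complex.re_mul_ofReal, Complex.conj_re]
  rw [dotProduct, Complex.re_sum, Finset.sum_congr rfl fun i _ => hterm i]
  obtain ⟨i, hi⟩ := Function.ne_iff.1 hu0
  exact Finset.sum_pos' (fun j _ => mul_nonneg (hpos j).le (Complex.normSq_nonneg _))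
    ⟨i, Finset.mem_univ i, mul_pos (hpos i) (Complex.normSq_pos.2 hi)⟩

theorem continuousAt_inv_one_sub_smul (M : Matrix (Fin n) (Fin n) ℂ) :
    ContinuousAt (fun z : ℂ => (1 - z • M)⁻¹) 0 := by
  simp only [inv_def, Ring.inverse_eq_inv']
  have h1 : Continuous fun z : ℂ => (1 - z • M).det := by fun_prop
  have h2 : Continuous fun z : ℂ => (1 - z • M).adjugate := by fun_prop
  exact (h1.continuousAt.inv₀ (by simp)).smul h2.continuousAt

theorem pencil_eq_smul {s : ℂ} (hs : s ≠ 0) : R.pencil s = s • (1 - s⁻¹ • R.Ac) := by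
  rw [pencil, scalar_apply, ← smul_one_eq_diagonal, smul_sub, smul_smul, mul_inv_cancel₀ hs,
    one_smul]

theorem smul_inv_pencil {s : ℂ} (hs : s ≠ 0) :
    s • (R.pencil s)⁻¹ = (1 - s⁻¹ • R.Ac)⁻¹ := by
  have h1 := R.pencil_eq_smul hs
  have : Invertible s := invertibleOfNonzero hs
  by_cases hu : IsUnit (1 - s⁻¹ • R.Ac).det
  · rw [h1, Matrix.inv_smul _ s hu, smul_smul, invOf_eq_inv, mul_inv_cancel₀ hs, one_smul]
  · have hu' : ¬ IsUnit (R.pencil s).det := by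
      rw [h1, det_smul, isUnit_iff_ne_zero, not_not]
      rw [isUnit_iff_ne_zero, not_not] at hu
      rw [hu, mul_zero]
    rw [nonsing_inv_apply_not_isUnit _ hu, nonsing_inv_apply_not_isUnit _ hu', smul_zero]

section Markov

variable {ι : Type*} {l : Filter ι} {s : ι → ℂ}

theorem eventually_det_one_sub_ne_zero (hs : Tendsto (fun t => (s t)⁻¹) l (𝓝 0)) :
    ∀ᶠ t in l, (1 - (s t)⁻¹ • R.Ac).det ≠ 0 := by
  have hd : Continuous fun z : ℂ => (1 - z • R.Ac).det := by fun_prop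
  exact ((hd.tendsto 0).comp hs).eventually_ne (by simp)

theorem eventually_det_pencil_ne_zero_of_tendsto (hs0 : ∀ᶠ t in l, s t ≠ 0)
    (hs : Tendsto (fun t => (s t)⁻¹) l (𝓝 0)) : ∀ᶠ t in l, (R.pencil (s t)).det ≠ 0 := by
  filter_upwards [hs0, eventually_det_one_sub_ne_zero (R := R) hs] with t ht htd
  rw [R.pencil_eq_smul ht, det_smul]
  exact mul_ne_zero (pow_ne_zero _ ht) htd

theorem tendsto_smul_transfer (hs0 : ∀ᶠ t in l, s t ≠ 0) (hs : Tendsto (fun t => (s t)⁻¹) l (𝓝 0)) :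
    Tendsto (fun t => s t • (R.ccᵀ * (R.pencil (s t))⁻¹ * R.Bc)) l (𝓝 (R.ccᵀ * R.Bc)) := by
  have h1 := (continuousAt_inv_one_sub_smul R.Ac).tendsto.comp hs
  have hc : Continuous fun M : Matrix (Fin n) (Fin n) ℂ => R.ccᵀ * M * R.Bc := by fun_prop
  have h2 := (hc.tendsto _).comp h1
  simp only [zero_smul, sub_zero, inv_one, Matrix.mul_one] at h2
  refine h2.congr' ?_
  filter_upwards [hs0] with t ht
  simp only [Function.comp_apply]
  rw [← R.smul_inv_pencil ht, Matrix.mul_smul, Matrix.smul_mul]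

/-- Second term of the expansion of the transfer matrix at infinity, from `s (s I - A)⁻¹ = (1 - s⁻¹
A)⁻¹`; the first term is `cᵀ B`. -/
theorem tendsto_smul_smul_transfer_sub (hs0 : ∀ᶠ t in l, s t ≠ 0)
    (hs : Tendsto (fun t => (s t)⁻¹) l (𝓝 0)) :
    Tendsto (fun t => s t • (s t • (R.ccᵀ * (R.pencil (s t))⁻¹ * R.Bc) - R.ccᵀ * R.Bc)) l
      (𝓝 (R.ccᵀ * R.Ac * R.Bc)) := by
  have h1 := (continuousAt_inv_one_sub_smul R.Ac).tendsto.comp hs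
  have hc : Continuous fun M : Matrix (Fin n) (Fin n) ℂ => R.ccᵀ * (R.Ac * M) * R.Bc := by fun_prop
  have h2 := (hc.tendsto _).comp h1
  simp only [zero_smul, sub_zero, inv_one, Matrix.mul_one] at h2
  refine h2.congr' ?_
  filter_upwards [hs0, eventually_det_one_sub_ne_zero (R := R) hs] with t ht htd
  simp only [Function.comp_apply]
  have h3 : s t • ((1 - (s t)⁻¹ • R.Ac)⁻¹ - 1) = R.Ac * (1 - (s t)⁻¹ • R.Ac)⁻¹ := by
    have h4 := mul_nonsing_inv _ (isUnit_iff_ne_zero.2 htd)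
    rw [Matrix.sub_mul, one_mul, Matrix.smul_mul] at h4
    have h5 : (1 - (s t)⁻¹ • R.Ac)⁻¹ - 1 = (s t)⁻¹ • (R.Ac * (1 - (s t)⁻¹ • R.Ac)⁻¹) := by
      rw [sub_eq_iff_eq_add, ← sub_eq_iff_eq_add']; exact h4
    rw [h5, smul_smul, mul_inv_cancel₀ ht, one_smul]
  rw [← h3, ← R.smul_inv_pencil ht]
  simp only [Matrix.mul_smul, Matrix.smul_mul, Matrix.mul_sub, Matrix.sub_mul, Matrix.mul_one]

end Markov

/-- The vertical line `-δ + i t`. -/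
def verticalLine (δ t : ℝ) : ℂ := ⟨-δ, t⟩

theorem verticalLine_ne_zero (δ : ℝ) : ∀ᶠ t in atTop, verticalLine δ t ≠ 0 := by
  filter_upwards [eventually_gt_atTop 0] with t ht h
  have := congrArg Complex.im h
  simp [verticalLine] at this
  exact ht.ne' this

theorem tendsto_inv_verticalLine (δ : ℝ) :
    Tendsto (fun t => (verticalLine δ t)⁻¹) atTop (𝓝 0) := by
  refine squeeze_zero_norm' ?_ tendsto_inv_atTop_zero
  filter_upwards [eventually_gt_atTop 0] with t ht
  rw [norm_inv]
  refine inv_anti₀ ht ?_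
  have := Complex.abs_im_le_norm (verticalLine δ t)
  rwa [verticalLine, abs_of_pos ht] at this

theorem tendsto_conj_div_verticalLine (δ : ℝ) :
    Tendsto (fun t => star (verticalLine δ t) * (verticalLine δ t)⁻¹) atTop (𝓝 (-1)) := by
  have h1 := ((tendsto_inv_verticalLine δ).const_mul (-(2 * δ) : ℂ)).sub_const 1
  rw [mul_zero, zero_sub] at h1
  refine h1.congr' ?_
  filter_upwards [verticalLine_ne_zero δ] with t ht
  have : star (verticalLine δ t) = -(2 * δ) - verticalLine δ t := by
    apply Complex.ext <;> simp [verticalLine] ; ring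
  rw [this, sub_mul, mul_inv_cancel₀ ht]

/-- A function with `f ~ μ / s + ν / s²` and nonnegative real part on `Re s = -δ` has
`ν ≤ -δ μ`. -/
theorem second_coefficient_le {f : ℂ → ℂ} {δ μ ν : ℝ}
    (hpos : ∀ᶠ t in atTop, 0 ≤ (f (verticalLine δ t)).re)
    (hν : Tendsto (fun t => verticalLine δ t * (verticalLine δ t * f (verticalLine δ t) - μ)) atTop
      (𝓝 (ν : ℂ))) : ν ≤ -(δ * μ) := by
  -- Multiplying by `s̄ / s → -1` turns the expression into `|s|² f - s̄ μ`, whose real part on the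
  -- line is at least `δ μ`.
  have h1 := (tendsto_conj_div_verticalLine δ).mul hν
  have h2 := (Complex.continuous_re.tendsto _).comp h1
  have h3 : Tendsto (fun t => -(δ * μ) + (star (verticalLine δ t) * (verticalLine δ t)⁻¹ *
      (verticalLine δ t * (verticalLine δ t * f (verticalLine δ t) - μ))).re) atTop
      (𝓝 (-(δ * μ) + -ν)) := by
    refine Tendsto.const_add _ ?_
    convert! h2 using 2
    simp
  have h4 : 0 ≤ -(δ * μ) + -ν := by
    refine ge_of_tendsto h3 ?_
    filter_upwards [hpos, verticalLine_ne_zero δ] with t ht ht0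
    set s := verticalLine δ t with hs
    have h5 : star s * s⁻¹ * (s * (s * f s - μ)) = (Complex.normSq s : ℂ) * f s - star s * μ := by
      rw [Complex.normSq_eq_conj_mul_self, Complex.star_def]
      field_simp
    rw [h5, Complex.sub_re, Complex.re_ofReal_mul, Complex.re_mul_ofReal]
    have h6 : (star s).re = -δ := by simp [hs, verticalLine]
    rw [h6]
    have := mul_nonneg (Complex.normSq_nonneg s) ht
    linarith
  linarith

/-- A stabilizable and detectable realization of an SPR `W_w` is Hurwitz and admits a KYP matrix. -/
theorem Realizes.exists_kyp_of_isSPR {R : StateSpace n m} {S : ShapedDesign m} {k : Fin m → ℝ}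
    (hR : R.Realizes (S.Ww k)) (hSPR : (S.Ww k).IsSPR) :
    ∃ P : Matrix (Fin n) (Fin n) ℝ, P.PosDef ∧ P * R.B = R.c ∧
      ∀ x : Fin n → ℝ, x ≠ 0 → x ⬝ᵥ (P *ᵥ (R.A *ᵥ x)) < 0 := by
  obtain ⟨htr, hstab, hdet⟩ := hR
  rw [S.Ww_eq_diagonal] at htr
  choose ε hε h using fun i => S.exists_re_div_nonneg_of_isSPR k hSPR i
  have hpos := fun i (s : ℂ) (hs : 0 ≤ s.re) =>
    S.re_num_div_den_pos k i (h i) (s := s) (by linarith [hε i])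
  have hD : ∀ i (s : ℂ), 0 ≤ s.re → aeval s (S.den k i) ≠ 0 := fun i s hs =>
    (h i s (by linarith [hε i])).2.1
  have hA : IsHurwitz R.A := isHurwitz_of_diagonal_transfer htr hD hstab hdet
  -- A line strictly left of the imaginary axis on which all channels still have nonnegative real
  -- part; `δ > 0` is what makes `cᵀ A B` negative below.
  obtain ⟨δ, hδ, hδε⟩ : ∃ δ : ℝ, 0 < δ ∧ ∀ i, δ < ε i := by
    rcases isEmpty_or_nonempty (Fin m) with hm | hm
    · exact ⟨1, one_pos, fun i => (hm.false i).elim⟩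
    · obtain ⟨i, hi⟩ := Finite.exists_min ε
      exact ⟨ε i / 2, half_pos (hε i), fun j => (half_lt_self (hε i)).trans_le (hi j)⟩
  have hline : ∀ i t, -ε i < (verticalLine δ t).re := fun i t => by
    have := hδε i
    simp [verticalLine]; exact this
  have h0 := verticalLine_ne_zero δ
  have hinv := tendsto_inv_verticalLine δ
  set w : ℂ → Fin m → ℂ := fun s i => aeval s (S.num i) / aeval s (S.den k i) with hw
  have hval : ∀ᶠ t in atTop, R.ccᵀ * (R.pencil (verticalLine δ t))⁻¹ * R.Bc
      = diagonal (w (verticalLine δ t)) := by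
    filter_upwards [R.eventually_det_pencil_ne_zero_of_tendsto h0 hinv] with t ht
    exact transfer_eval_of_diagonal htr (fun i => (h i _ (hline i t)).2.1) ht
  have hmul : ∀ {a b d : ℕ} (M : Matrix (Fin a) (Fin b) ℝ) (K : Matrix (Fin b) (Fin d) ℝ),
      (M * K).map Complex.ofReal = M.map Complex.ofReal * K.map Complex.ofReal :=
    fun M K => Matrix.map_mul (f := Complex.ofRealHom)
  have hcB : R.cᵀ * R.B = diagonal fun i => S.φ i / S.J i := by
    have h1 := R.tendsto_smul_transfer h0 hinv
    have h2 : R.ccᵀ * R.Bc = diagonal fun i => ((S.φ i / S.J i : ℝ) : ℂ) := by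
      ext i j
      have h3 := (tendsto_pi_nhds.1 ((tendsto_pi_nhds.1 h1) i)) j
      refine tendsto_nhds_unique h3 ?_
      rcases eq_or_ne i j with rfl | hij
      · rw [diagonal_apply_eq]
        refine (S.tendsto_mul_num_div_den k i h0 hinv).congr' ?_
        filter_upwards [hval] with t ht
        rw [ht, Matrix.smul_apply, diagonal_apply_eq, smul_eq_mul]
      · rw [diagonal_apply_ne _ hij]
        refine tendsto_const_nhds.congr' ?_
        filter_upwards [hval] with t ht
        rw [ht, Matrix.smul_apply, diagonal_apply_ne _ hij, smul_zero]
    rw [← transpose_map, ← hmul] at h2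
    ext i j
    have h3 := congrFun (congrFun h2 i) j
    rw [map_apply] at h3
    rcases eq_or_ne i j with rfl | hij
    · rw [diagonal_apply_eq] at h3 ⊢; exact_mod_cast h3
    · rw [diagonal_apply_ne _ hij] at h3 ⊢; exact_mod_cast h3
  have hcB' : R.ccᵀ * R.Bc = diagonal fun i => ((S.φ i / S.J i : ℝ) : ℂ) := by
    rw [← transpose_map, ← hmul, hcB, diagonal_map Complex.ofReal_zero]
  have h2lim := R.tendsto_smul_smul_transfer_sub h0 hinv
  have hcAB' : (R.cᵀ * R.A * R.B).map Complex.ofReal = R.ccᵀ * R.Ac * R.Bc := by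
    rw [hmul, hmul, transpose_map]
  rw [← hcAB', hcB'] at h2lim
  have hentry : ∀ i j, Tendsto (fun t => (verticalLine δ t • (verticalLine δ t •
      diagonal (w (verticalLine δ t)) - diagonal fun i => ((S.φ i / S.J i : ℝ) : ℂ))
        : Matrix (Fin m) (Fin m) ℂ) i j) atTop (𝓝 (((R.cᵀ * R.A * R.B) i j : ℝ) : ℂ)) := by
    intro i j
    refine ((tendsto_pi_nhds.1 ((tendsto_pi_nhds.1 h2lim) i)) j).congr' ?_
    filter_upwards [hval] with t ht
    rw [ht]
  have hcAB : R.cᵀ * R.A * R.B = diagonal fun i => (R.cᵀ * R.A * R.B) i i := by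
    ext i j
    rcases eq_or_ne i j with rfl | hij
    · rw [diagonal_apply_eq]
    · rw [diagonal_apply_ne _ hij]
      have h3 := hentry i j
      simp only [Matrix.smul_apply, Matrix.sub_apply, diagonal_apply_ne _ hij, smul_zero,
        sub_zero] at h3
      exact_mod_cast (tendsto_nhds_unique tendsto_const_nhds h3).symm
  have hμ : ∀ i, 0 < S.φ i / S.J i := fun i => div_pos (S.φ_pos i) (S.J_pos i)
  have hν : ∀ i, (R.cᵀ * R.A * R.B) i i < 0 := by
    intro i
    have h3 := hentry i i
    simp only [Matrix.smul_apply, Matrix.sub_apply, diagonal_apply_eq, smul_eq_mul] at h3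
    have h4 := second_coefficient_le (f := fun s => w s i)
      (Eventually.of_forall fun t => (h i _ (hline i t)).2.2) h3
    have := mul_pos hδ (hμ i)
    linarith
  obtain ⟨P, hPs, hPB, hP⟩ := exists_kyp_matrix R.A R.B R.c _ _ hμ hν hcB hcAB (by
    intro ω x u hx hxu
    have hre : ((ω : ℂ) * Complex.I).re = 0 := by simp
    exact re_response_pos htr hA hre.ge (fun i => hD i _ hre.ge) (fun i => hpos i _ hre.ge) hx hxu)
  exact ⟨P, hA.posDef_of_lyapunov hPs hP, hPB, hP⟩

end StateSpace

/-! ### Bounded signals, filters and a Barbalat lemma -/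

section Signals

open MeasureTheory

/-- `f` is bounded on `[0, ∞)`. -/
def IsBoundedSignal (f : ℝ → ℝ) : Prop := ∃ M : ℝ, ∀ t : ℝ, 0 ≤ t → |f t| ≤ M

namespace IsBoundedSignal

variable {f g : ℝ → ℝ}

theorem const (c : ℝ) : IsBoundedSignal fun _ => c := ⟨|c|, fun _ _ => le_rfl⟩

theorem add (hf : IsBoundedSignal f) (hg : IsBoundedSignal g) :
    IsBoundedSignal fun t => f t + g t := by
  obtain ⟨M, hM⟩ := hf
  obtain ⟨N, hN⟩ := hg
  exact ⟨M + N, fun t ht => (abs_add_le _ _).trans (add_le_add (hM t ht) (hN t ht))⟩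

theorem mul (hf : IsBoundedSignal f) (hg : IsBoundedSignal g) :
    IsBoundedSignal fun t => f t * g t := by
  obtain ⟨M, hM⟩ := hf
  obtain ⟨N, hN⟩ := hg
  refine ⟨M * N, fun t ht => ?_⟩
  rw [abs_mul]
  exact mul_le_mul (hM t ht) (hN t ht) (abs_nonneg _) ((abs_nonneg _).trans (hM t ht))

theorem sub (hf : IsBoundedSignal f) (hg : IsBoundedSignal g) :
    IsBoundedSignal fun t => f t - g t := by
  have := hf.add ((const (-1)).mul hg)
  simpa [sub_eq_add_neg] using this

theorem sum {ι : Type*} (s : Finset ι) {F : ι → ℝ → ℝ} (h : ∀ i, IsBoundedSignal (F i)) :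
    IsBoundedSignal fun t => ∑ i ∈ s, F i t := by
  choose M hM using h
  exact ⟨∑ i ∈ s, M i, fun t ht => (Finset.abs_sum_le_sum_abs _ _).trans
    (Finset.sum_le_sum fun i _ => hM i t ht)⟩

theorem mulVec {ι κ : Type*} [Fintype κ] {M : ℝ → Matrix ι κ ℝ} {v : ℝ → κ → ℝ}
    (hM : ∀ i j, IsBoundedSignal fun t => M t i j) (hv : ∀ j, IsBoundedSignal fun t => v t j)
    (i : ι) : IsBoundedSignal fun t => (M t *ᵥ v t) i :=
  sum Finset.univ fun j => (hM i j).mul (hv j)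

theorem congr (hf : IsBoundedSignal f) (h : ∀ t, 0 ≤ t → f t = g t) : IsBoundedSignal g := by
  obtain ⟨M, hM⟩ := hf
  exact ⟨M, fun t ht => h t ht ▸ hM t ht⟩

theorem exists_common {ι : Type*} [Finite ι] {F : ι → ℝ → ℝ} (h : ∀ i, IsBoundedSignal (F i)) :
    ∃ M : ℝ, ∀ t, 0 ≤ t → ∀ i, |F i t| ≤ M := by
  choose M hM using h
  obtain ⟨K, hK⟩ := (Set.finite_range M).bddAbove
  exact ⟨K, fun t ht i => (hM i t ht).trans (hK ⟨i, rfl⟩)⟩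

end IsBoundedSignal

namespace HasTimeDeriv

variable {f g : ℝ → ℝ}

theorem hasDerivAt (h : HasTimeDeriv f g) {t : ℝ} (ht : 0 < t) : HasDerivAt f (g t) t :=
  (h t ht.le).hasDerivAt (Ici_mem_nhds ht)

theorem continuousOn (h : HasTimeDeriv f g) : ContinuousOn f (Set.Ici 0) := fun t ht =>
  (h t ht).continuousWithinAt

theorem antitoneOn (h : HasTimeDeriv f g) (hg : ∀ t, 0 ≤ t → g t ≤ 0) :
    AntitoneOn f (Set.Ici 0) := by
  refine antitoneOn_of_hasDerivWithinAt_nonpos (f' := g) (convex_Ici 0) h.continuousOn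
    (fun t ht => ?_) fun t ht => hg t (interior_subset ht)
  exact (h t (interior_subset ht)).mono interior_subset

theorem aestronglyMeasurable (h : HasTimeDeriv f g) :
    AEStronglyMeasurable f (volume.restrict (Set.Ioi 0)) :=
  (h.continuousOn.mono Set.Ioi_subset_Ici_self).aestronglyMeasurable measurableSet_Ioi

theorem aestronglyMeasurable_deriv (h : HasTimeDeriv f g) :
    AEStronglyMeasurable g (volume.restrict (Set.Ioi 0)) := by
  refine (stronglyMeasurable_deriv f).aestronglyMeasurable.congr ?_
  filter_upwards [ae_restrict_mem measurableSet_Ioi] with t ht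
  exact (h.hasDerivAt ht).deriv

/-- A nonnegative function with nonpositive derivative has an integrable derivative. -/
theorem integrableOn_of_nonpos (h : HasTimeDeriv f g) (hf : ∀ t, 0 ≤ t → 0 ≤ f t)
    (hg : ∀ t, 0 ≤ t → g t ≤ 0) : IntegrableOn g (Set.Ioi 0) := by
  -- Time is clamped at `0`, giving a function monotone on all of `ℝ`.
  have hanti : Antitone fun t => f (max t 0) := fun a b hab =>
    h.antitoneOn hg (le_max_right a 0) (le_max_right b 0) (max_le_max_right 0 hab)
  have hbdd : BddBelow (Set.range fun t => f (max t 0)) :=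
    ⟨0, by rintro _ ⟨t, rfl⟩; exact hf _ (le_max_right t 0)⟩
  have hlim := (tendsto_atTop_ciInf hanti hbdd).congr' (f₂ := f) (by
    filter_upwards [eventually_ge_atTop 0] with t ht
    rw [max_eq_left ht])
  exact integrableOn_Ioi_deriv_of_nonpos (h 0 le_rfl).continuousWithinAt
    (fun t ht => h.hasDerivAt ht) (fun t ht => hg t (le_of_lt ht)) hlim

/-- Barbalat's lemma for square-integrable signals with bounded derivative. -/
theorem tendsto_zero_of_integrableOn_sq (h : HasTimeDeriv f g) (hf : IsBoundedSignal f)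
    (hg : IsBoundedSignal g) (hint : IntegrableOn (fun t => f t ^ 2) (Set.Ioi 0)) :
    Tendsto f atTop (𝓝 0) := by
  obtain ⟨M, hM⟩ := hf
  obtain ⟨N, hN⟩ := hg
  -- The cube works where the square would not: `f³` and its derivative `3 f² g` are both
  -- integrable, being bounded multiples of `f²`.
  have h1 : IntegrableOn (fun t => f t ^ 3) (Set.Ioi 0) := by
    have := Integrable.bdd_mul (c := M) hint h.aestronglyMeasurable (by
      filter_upwards [ae_restrict_mem measurableSet_Ioi] with t ht
      exact hM t (le_of_lt ht))
    refine this.congr (Eventually.of_forall fun t => ?_)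
    simp only; ring
  have h2 : IntegrableOn (fun t => 3 * f t ^ 2 * g t) (Set.Ioi 0) := by
    have := (Integrable.bdd_mul (c := N) hint h.aestronglyMeasurable_deriv (by
      filter_upwards [ae_restrict_mem measurableSet_Ioi] with t ht
      exact hN t (le_of_lt ht))).const_mul 3
    refine this.congr (Eventually.of_forall fun t => ?_)
    simp only; ring
  have h3 : Tendsto (fun t => f t ^ 3) atTop (𝓝 0) := by
    refine tendsto_zero_of_hasDerivAt_of_integrableOn_Ioi (a := 0) (f' := fun t => 3 * f t ^ 2 * g t)
      (fun t ht => ?_) h2 h1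
    simpa using (h.hasDerivAt ht).fun_pow 3
  rw [Metric.tendsto_atTop] at h3 ⊢
  intro ε hε
  obtain ⟨T, hT⟩ := h3 (ε ^ 3) (by positivity)
  refine ⟨T, fun t ht => ?_⟩
  have := hT t ht
  rw [Real.dist_eq, sub_zero, abs_pow] at this
  rw [Real.dist_eq, sub_zero]
  exact lt_of_pow_lt_pow_left₀ 3 hε.le this

/-- With integrating factor, `exp (θ t) (y - K / θ)` has derivative `exp (θ t) (u - K) ≤ 0`. -/
theorem upper_bound_of_filter {y u : ℝ → ℝ} {θ : ℝ} (hθ : 0 < θ)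
    (h : HasTimeDeriv y fun t => u t - θ * y t) {K : ℝ} (hu : ∀ t, 0 ≤ t → u t ≤ K) :
    ∀ t, 0 ≤ t → y t ≤ K / θ + |y 0 - K / θ| := by
  intro t ht
  have h1 : HasTimeDeriv (fun t => Real.exp (θ * t) * (y t - K / θ))
      fun t => Real.exp (θ * t) * (u t - K) := by
    intro t ht
    have e1 : HasDerivWithinAt (fun t => Real.exp (θ * t)) (Real.exp (θ * t) * θ) (Set.Ici 0) t := by
      have := ((hasDerivAt_id t).const_mul θ).exp.hasDerivWithinAt (s := Set.Ici 0)
      simpa using this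
    convert! e1.mul ((h t ht).sub_const (K / θ)) using 1
    field_simp
    ring
  have h2 := h1.antitoneOn (fun t ht => mul_nonpos_of_nonneg_of_nonpos (Real.exp_pos _).le
    (sub_nonpos.2 (hu t ht))) Set.self_mem_Ici ht ht
  simp only [mul_zero, Real.exp_zero, one_mul] at h2
  by_contra! hlt
  have h3 : |y 0 - K / θ| < y t - K / θ := by linarith
  have h4 : 1 ≤ Real.exp (θ * t) := Real.one_le_exp (by positivity)
  have h5 : y t - K / θ ≤ Real.exp (θ * t) * (y t - K / θ) :=
    le_mul_of_one_le_left ((abs_nonneg _).trans h3.le) h4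
  linarith [le_abs_self (y 0 - K / θ)]

/-- A stable first-order filter maps bounded signals to bounded signals. -/
theorem isBoundedSignal_of_filter {y u : ℝ → ℝ} {θ : ℝ} (hθ : 0 < θ)
    (h : HasTimeDeriv y fun t => u t - θ * y t) (hu : IsBoundedSignal u) : IsBoundedSignal y := by
  obtain ⟨K, hK⟩ := hu
  have h1 := upper_bound_of_filter hθ h (fun t ht => (abs_le.1 (hK t ht)).2)
  have hneg : HasTimeDeriv (fun t => -y t) fun t => -u t - θ * -y t := by
    intro t ht
    convert! (h t ht).neg using 1
    ring
  have h2 := upper_bound_of_filter hθ hneg (K := K)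
    (fun t ht => by linarith [(abs_le.1 (hK t ht)).1])
  refine ⟨K / θ + |y 0 - K / θ| + |-y 0 - K / θ|, fun t ht => abs_le.2 ⟨?_, ?_⟩⟩
  · linarith [h2 t ht, abs_nonneg (y 0 - K / θ)]
  · linarith [h1 t ht, abs_nonneg (-y 0 - K / θ)]

end HasTimeDeriv

/-- Compactness of the unit sphere and homogeneity. Symmetry is not assumed, so that it also applies
to `-(P A)`. -/
theorem exists_quadratic_lower_bound {n : ℕ} (M : Matrix (Fin n) (Fin n) ℝ)
    (hM : ∀ x : Fin n → ℝ, x ≠ 0 → 0 < x ⬝ᵥ (M *ᵥ x)) :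
    ∃ α : ℝ, 0 < α ∧ ∀ x : Fin n → ℝ, ∀ j, α * x j ^ 2 ≤ x ⬝ᵥ (M *ᵥ x) := by
  rcases isEmpty_or_nonempty (Fin n) with hn | hn
  · exact ⟨1, one_pos, fun x j => (hn.false j).elim⟩
  have hcont : Continuous fun x : Fin n → ℝ => x ⬝ᵥ (M *ᵥ x) := by fun_prop
  obtain ⟨y, hy, hmin⟩ := (isCompact_sphere (0 : Fin n → ℝ) 1).exists_isMinOn
    (NormedSpace.sphere_nonempty.2 zero_le_one) hcont.continuousOn
  have hy0 : y ≠ 0 := by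
    rintro rfl; simp at hy
  refine ⟨_, hM y hy0, fun x j => ?_⟩
  rcases eq_or_ne x 0 with rfl | hx
  · simp
  have hx' : 0 < ‖x‖ := norm_pos_iff.2 hx
  have h1 := hmin (show ‖x‖⁻¹ • x ∈ Metric.sphere (0 : Fin n → ℝ) 1 by
    rw [mem_sphere_zero_iff_norm, norm_smul, norm_inv, norm_norm, inv_mul_cancel₀ hx'.ne'])
  simp only [Set.mem_ofPred_eq, mulVec_smul, dotProduct_smul, smul_dotProduct, smul_eq_mul] at h1
  have h2 : x j ^ 2 ≤ ‖x‖ ^ 2 := sq_le_sq.2 (by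
    rw [abs_norm]; exact norm_le_pi_norm x j)
  calc _ ≤ (‖x‖⁻¹ * (‖x‖⁻¹ * (x ⬝ᵥ (M *ᵥ x)))) * ‖x‖ ^ 2 :=
        mul_le_mul h1 h2 (sq_nonneg _) ((hM y hy0).le.trans h1)
    _ = x ⬝ᵥ (M *ᵥ x) := by field_simp

theorem hasTimeDeriv_quadratic {n : ℕ} {P : Matrix (Fin n) (Fin n) ℝ} (hP : P.IsSymm)
    {x x' : ℝ → Fin n → ℝ} (h : ∀ j, HasTimeDeriv (fun t => x t j) fun t => x' t j) :
    HasTimeDeriv (fun t => x t ⬝ᵥ (P *ᵥ x t)) fun t => 2 * (x t ⬝ᵥ (P *ᵥ x' t)) := by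
  intro t ht
  have h1 : HasDerivWithinAt (fun t => x t ⬝ᵥ (P *ᵥ x t))
      (∑ i, (x' t i * (P *ᵥ x t) i + x t i * (P *ᵥ x' t) i)) (Set.Ici 0) t := by
    simp only [dotProduct, mulVec]
    refine HasDerivWithinAt.fun_sum fun i _ => ?_
    refine (h i t ht).mul (HasDerivWithinAt.fun_sum fun j _ => ?_)
    exact (h j t ht).const_mul (P i j)
  convert! h1 using 1
  have h2 : ∑ i, x' t i * (P *ᵥ x t) i = x t ⬝ᵥ (P *ᵥ x' t) := by
    change x' t ⬝ᵥ (P *ᵥ x t) = _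
    rw [dotProduct_mulVec, ← mulVec_transpose, hP.eq, dotProduct_comm]
  rw [Finset.sum_add_distrib, h2]
  exact two_mul _

end Signals

/-! ### The adaptive loop: energy, boundedness and convergence -/

namespace LoopSignals.Solves

open MeasureTheory

variable {n m : ℕ} {σ : LoopSignals n m} {G : LeaderNetwork m} {S : ShapedDesign m}
  {k : Fin m → ℝ} {R : StateSpace n m} {Γ : Matrix (Fin m) (Fin m) ℝ}

/-- The composite Lyapunov function of the adaptive loop. -/
def energy (σ : LoopSignals n m) (S : ShapedDesign m) (k : Fin m → ℝ) (Γ : Matrix (Fin m) (Fin m) ℝ)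
    (P : Matrix (Fin n) (Fin n) ℝ) (t : ℝ) : ℝ :=
  σ.ex t ⬝ᵥ (P *ᵥ σ.ex t)
    + ∑ l, (fun i => σ.XiTilde S k t i l) ⬝ᵥ (Γ⁻¹ *ᵥ fun i => σ.XiTilde S k t i l)

theorem hasTimeDeriv_energy (h : σ.Solves G S k R Γ) (hΓ : Γ.PosDef)
    {P : Matrix (Fin n) (Fin n) ℝ} (hP : P.PosDef) (hPB : P * R.B = R.c) :
    HasTimeDeriv (energy σ S k Γ P) fun t => 2 * (σ.ex t ⬝ᵥ (P *ᵥ (R.A *ᵥ σ.ex t))) := by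
  have hPs : P.IsSymm := by
    have := hP.isHermitian
    rwa [IsHermitian, conjTranspose_eq_transpose_of_trivial] at this
  have hΓs : Γ⁻¹.IsSymm := by
    have := hΓ.inv.isHermitian
    rwa [IsHermitian, conjTranspose_eq_transpose_of_trivial] at this
  have hΓu : IsUnit Γ.det := (isUnit_iff_isUnit_det _).1 hΓ.isUnit
  intro t ht
  have h1 := hasTimeDeriv_quadratic hPs h.state t ht
  have h2 := fun l => hasTimeDeriv_quadratic hΓs (x := fun t i => σ.XiTilde S k t i l)
    (x' := fun t i => -(Γ * vecMulVec (σ.err G t) (σ.etaBar t)) i l)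
    (fun i => h.gradient i l) t ht
  have h3 := h1.add (HasDerivWithinAt.fun_sum (u := Finset.univ) fun l _ => h2 l)
  refine HasDerivWithinAt.congr_deriv h3 ?_
  set e := σ.err G t with he
  set η := σ.etaBar t with hη
  set Ξ := σ.XiTilde S k t with hΞ
  set x := σ.ex t with hx
  -- `Γ⁻¹` in the energy cancels `Γ` in the adaptive law; summed over columns this is `-e ⬝ Ξ̃ η̄`,
  -- the opposite of the state's cross term in `hpass`, where `P B = c` enters.
  have hgrad : ∀ l, (fun i => Ξ i l) ⬝ᵥ (Γ⁻¹ *ᵥ fun i => -(Γ * vecMulVec e η) i l)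
      = -(∑ i, e i * (Ξ i l * η l)) := by
    intro l
    have e1 : (fun i => -(Γ * vecMulVec e η) i l) = -(η l • (Γ *ᵥ e)) := by
      ext i
      rw [mul_vecMulVec, vecMulVec_apply]
      simp [mul_comm]
    rw [e1, mulVec_neg, mulVec_smul, mulVec_mulVec, nonsing_inv_mul _ hΓu, one_mulVec, dotProduct_neg,
      dotProduct_smul, dotProduct, smul_eq_mul, Finset.mul_sum]
    congr 1
    refine Finset.sum_congr rfl fun i _ => by ring
  have hpass : x ⬝ᵥ (P *ᵥ (R.B *ᵥ (Ξ *ᵥ η))) = ∑ l, ∑ i, e i * (Ξ i l * η l) := by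
    have e2 : e = R.cᵀ *ᵥ x := h.output t ht
    have e3 : x ⬝ᵥ (P *ᵥ (R.B *ᵥ (Ξ *ᵥ η))) = e ⬝ᵥ (Ξ *ᵥ η) := by
      rw [mulVec_mulVec, hPB, dotProduct_mulVec, ← mulVec_transpose, ← e2]
    rw [e3, Finset.sum_comm]
    simp only [dotProduct, mulVec, Finset.mul_sum]
  change 2 * (x ⬝ᵥ (P *ᵥ (R.A *ᵥ x + R.B *ᵥ (Ξ *ᵥ η))))
    + ∑ l, 2 * ((fun i => Ξ i l) ⬝ᵥ (Γ⁻¹ *ᵥ fun i => -(Γ * vecMulVec e η) i l))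
    = 2 * (x ⬝ᵥ (P *ᵥ (R.A *ᵥ x)))
  rw [← Finset.mul_sum, Finset.sum_congr rfl fun l _ => hgrad l, mulVec_add, dotProduct_add, hpass,
    Finset.sum_neg_distrib]
  ring

section Lyapunov

variable {P : Matrix (Fin n) (Fin n) ℝ}

theorem energy_terms_nonneg (hΓ : Γ.PosDef) (t : ℝ) (l : Fin 3 × Fin m) :
    0 ≤ (fun i => σ.XiTilde S k t i l) ⬝ᵥ (Γ⁻¹ *ᵥ fun i => σ.XiTilde S k t i l) := by
  simpa using hΓ.inv.posSemidef.dotProduct_mulVec_nonneg fun i => σ.XiTilde S k t i l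

theorem state_energy_nonneg (hP : P.PosDef) (t : ℝ) : 0 ≤ σ.ex t ⬝ᵥ (P *ᵥ σ.ex t) := by
  simpa using hP.posSemidef.dotProduct_mulVec_nonneg (σ.ex t)

theorem energy_nonneg (hΓ : Γ.PosDef) (hP : P.PosDef) (t : ℝ) : 0 ≤ energy σ S k Γ P t :=
  add_nonneg (state_energy_nonneg hP t) (Finset.sum_nonneg fun l _ => energy_terms_nonneg hΓ t l)

theorem dissipation_nonpos (hneg : ∀ x : Fin n → ℝ, x ≠ 0 → x ⬝ᵥ (P *ᵥ (R.A *ᵥ x)) < 0)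
    (x : Fin n → ℝ) : 2 * (x ⬝ᵥ (P *ᵥ (R.A *ᵥ x))) ≤ 0 := by
  rcases eq_or_ne x 0 with rfl | hx
  · simp
  · linarith [hneg x hx]

theorem energy_le (h : σ.Solves G S k R Γ) (hΓ : Γ.PosDef) (hP : P.PosDef) (hPB : P * R.B = R.c)
    (hneg : ∀ x : Fin n → ℝ, x ≠ 0 → x ⬝ᵥ (P *ᵥ (R.A *ᵥ x)) < 0) {t : ℝ} (ht : 0 ≤ t) :
    energy σ S k Γ P t ≤ energy σ S k Γ P 0 :=
  (h.hasTimeDeriv_energy hΓ hP hPB).antitoneOn (fun _ _ => dissipation_nonpos hneg _)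
    Set.self_mem_Ici ht ht

theorem isBoundedSignal_ex (h : σ.Solves G S k R Γ) (hΓ : Γ.PosDef) (hP : P.PosDef)
    (hPB : P * R.B = R.c) (hneg : ∀ x : Fin n → ℝ, x ≠ 0 → x ⬝ᵥ (P *ᵥ (R.A *ᵥ x)) < 0)
    (j : Fin n) : IsBoundedSignal fun t => σ.ex t j := by
  obtain ⟨α, hα, hlb⟩ := exists_quadratic_lower_bound P fun x hx => by
    simpa using hP.dotProduct_mulVec_pos hx
  refine ⟨√(energy σ S k Γ P 0 / α), fun t ht => Real.abs_le_sqrt ?_⟩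
  rw [le_div_iff₀' hα]
  refine (hlb (σ.ex t) j).trans (le_trans ?_ (h.energy_le hΓ hP hPB hneg ht))
  exact le_add_of_nonneg_right (Finset.sum_nonneg fun l _ => energy_terms_nonneg hΓ t l)

theorem isBoundedSignal_XiTilde (h : σ.Solves G S k R Γ) (hΓ : Γ.PosDef) (hP : P.PosDef)
    (hPB : P * R.B = R.c) (hneg : ∀ x : Fin n → ℝ, x ≠ 0 → x ⬝ᵥ (P *ᵥ (R.A *ᵥ x)) < 0)
    (i : Fin m) (l : Fin 3 × Fin m) : IsBoundedSignal fun t => σ.XiTilde S k t i l := by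
  obtain ⟨α, hα, hlb⟩ := exists_quadratic_lower_bound Γ⁻¹ fun x hx => by
    simpa using hΓ.inv.dotProduct_mulVec_pos hx
  refine ⟨√(energy σ S k Γ P 0 / α), fun t ht => Real.abs_le_sqrt ?_⟩
  rw [le_div_iff₀' hα]
  refine (hlb (fun i => σ.XiTilde S k t i l) i).trans (le_trans ?_ (h.energy_le hΓ hP hPB hneg ht))
  exact (Finset.single_le_sum (fun l _ => energy_terms_nonneg hΓ t l) (Finset.mem_univ l)).trans
    (le_add_of_nonneg_left (state_energy_nonneg hP t))

theorem integrableOn_sq_ex (h : σ.Solves G S k R Γ) (hΓ : Γ.PosDef) (hP : P.PosDef)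
    (hPB : P * R.B = R.c) (hneg : ∀ x : Fin n → ℝ, x ≠ 0 → x ⬝ᵥ (P *ᵥ (R.A *ᵥ x)) < 0)
    (j : Fin n) : IntegrableOn (fun t => σ.ex t j ^ 2) (Set.Ioi 0) := by
  obtain ⟨α, hα, hlb⟩ := exists_quadratic_lower_bound (-(P * R.A)) fun x hx => by
    rw [neg_mulVec, dotProduct_neg, ← mulVec_mulVec]
    linarith [hneg x hx]
  have hint := (h.hasTimeDeriv_energy hΓ hP hPB).integrableOn_of_nonpos
    (fun t _ => energy_nonneg hΓ hP t) (fun _ _ => dissipation_nonpos hneg _)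
  refine Integrable.mono' (hint.const_mul (-(2 * α)⁻¹)) ((h.state j).aestronglyMeasurable.pow 2)
    (Eventually.of_forall fun t => ?_)
  have h1 := hlb (σ.ex t) j
  rw [neg_mulVec, dotProduct_neg, ← mulVec_mulVec] at h1
  rw [Real.norm_of_nonneg (sq_nonneg _)]
  have h2 : -(2 * α)⁻¹ * (2 * (σ.ex t ⬝ᵥ (P *ᵥ (R.A *ᵥ σ.ex t))))
      = α⁻¹ * -(σ.ex t ⬝ᵥ (P *ᵥ (R.A *ᵥ σ.ex t))) := by
    field_simp
  rw [h2, ← div_eq_inv_mul, le_div_iff₀' hα]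
  exact h1

end Lyapunov

theorem isBoundedSignal_err (h : σ.Solves G S k R Γ)
    (hex : ∀ j, IsBoundedSignal fun t => σ.ex t j) (i : Fin m) :
    IsBoundedSignal fun t => σ.err G t i :=
  (IsBoundedSignal.mulVec (M := fun _ => R.cᵀ) (fun _ _ => IsBoundedSignal.const _) hex i).congr
    fun t ht => congrFun (h.output t ht).symm i

/-- Differentiating the filter identity trades the leader position for its velocity and
acceleration. Hence `Ω̇` obeys a stable filter with rate `p` and is bounded even if `x₀` is not. -/
theorem ddOm_eq (h : σ.Solves G S k R Γ) (i : Fin m) {t : ℝ} (ht : 0 ≤ t) :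
    σ.ddOm t i = (S.φ i)⁻¹ * (σ.a0 t + S.q i * σ.v0 t) - S.p i * σ.dOm t i := by
  have h1 : HasDerivWithinAt (fun t => S.φ i * (σ.dOm t i + S.p i * σ.Om t i))
      (S.φ i * (σ.ddOm t i + S.p i * σ.dOm t i)) (Set.Ici 0) t :=
    ((h.dOm_deriv i t ht).add ((h.Om_deriv i t ht).const_mul _)).const_mul _
  have h2 : HasDerivWithinAt (fun t => S.φ i * (σ.dOm t i + S.p i * σ.Om t i))
      (σ.a0 t + S.q i * σ.v0 t) (Set.Ici 0) t := by
    refine ((h.leader_acc t ht).add ((h.leader_vel t ht).const_mul (S.q i))).congr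
      (fun s hs => h.Om_filter s hs i) (h.Om_filter t ht i)
  have h3 := (uniqueDiffOn_Ici (0 : ℝ) t ht).eq_deriv _ h1 h2
  rw [← h3, inv_mul_cancel_left₀ (S.φ_pos i).ne']
  ring

theorem isBoundedSignal_dOm (h : σ.Solves G S k R Γ) (hv : IsBoundedSignal σ.v0)
    (ha : IsBoundedSignal σ.a0) (i : Fin m) : IsBoundedSignal fun t => σ.dOm t i := by
  refine HasTimeDeriv.isBoundedSignal_of_filter (S.p_pos i)
    (u := fun t => (S.φ i)⁻¹ * (σ.a0 t + S.q i * σ.v0 t)) (fun t ht => ?_)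
    ((IsBoundedSignal.const _).mul (ha.add ((IsBoundedSignal.const _).mul hv)))
  exact (h.dOm_deriv i t ht).congr_deriv (h.ddOm_eq i ht)

theorem isBoundedSignal_ddOm (h : σ.Solves G S k R Γ) (hv : IsBoundedSignal σ.v0)
    (ha : IsBoundedSignal σ.a0) (i : Fin m) : IsBoundedSignal fun t => σ.ddOm t i :=
  (((IsBoundedSignal.const _).mul (ha.add ((IsBoundedSignal.const _).mul hv))).sub
    ((IsBoundedSignal.const _).mul (h.isBoundedSignal_dOm hv ha i))).congr
    fun _ ht => (h.ddOm_eq i ht).symm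

theorem isBoundedSignal_etaBar (h : σ.Solves G S k R Γ) (hv : IsBoundedSignal σ.v0)
    (ha : IsBoundedSignal σ.a0) (hex : ∀ j, IsBoundedSignal fun t => σ.ex t j)
    (l : Fin 3 × Fin m) : IsBoundedSignal fun t => σ.etaBar t l := by
  refine HasTimeDeriv.isBoundedSignal_of_filter (S.θ_pos l.2) (h.prefilter l) ?_
  obtain ⟨a, i⟩ := l
  fin_cases a
  · exact h.isBoundedSignal_err hex i
  · exact h.isBoundedSignal_ddOm hv ha i
  · exact h.isBoundedSignal_dOm hv ha i

/-- Bounded state, parameter error and regressor bound the derivative of `e_x`; square integrability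
then forces decay. -/
theorem tendsto_ex (h : σ.Solves G S k R Γ) (hv : IsBoundedSignal σ.v0)
    (ha : IsBoundedSignal σ.a0) (hex : ∀ j, IsBoundedSignal fun t => σ.ex t j)
    (hXi : ∀ i l, IsBoundedSignal fun t => σ.XiTilde S k t i l)
    (hint : ∀ j, IntegrableOn (fun t => σ.ex t j ^ 2) (Set.Ioi 0)) :
    Tendsto σ.ex atTop (𝓝 0) := by
  refine tendsto_pi_nhds.2 fun j => (h.state j).tendsto_zero_of_integrableOn_sq (hex j) ?_ (hint j)
  refine IsBoundedSignal.add ?_ ?_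
  · exact IsBoundedSignal.mulVec (M := fun _ => R.A) (fun _ _ => IsBoundedSignal.const _) hex j
  · exact IsBoundedSignal.mulVec (M := fun _ => R.B) (fun _ _ => IsBoundedSignal.const _)
      (IsBoundedSignal.mulVec hXi (h.isBoundedSignal_etaBar hv ha hex)) j

theorem tendsto_err (h : σ.Solves G S k R Γ) (hex : Tendsto σ.ex atTop (𝓝 0)) :
    Tendsto (σ.err G) atTop (𝓝 0) := by
  have hc : Continuous fun x : Fin n → ℝ => R.cᵀ *ᵥ x := by fun_prop
  have h1 := (hc.tendsto 0).comp hex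
  rw [mulVec_zero] at h1
  refine h1.congr' ?_
  filter_upwards [eventually_ge_atTop 0] with t ht
  exact (h.output t ht).symm

end LoopSignals.Solves

end

/-! ### The main theorem -/

theorem mainTheorem4 {m : ℕ} (G : LeaderNetwork m) (S : ShapedDesign m) :
    -- the composite transfer is diagonal and every channel has relative degree one
    (∀ k : Fin m → ℝ, (S.Ww k).IsDiag ∧ ∀ i, relativeDegree (S.Ww k i i) = 1) ∧
    -- it is rendered SPR by the shaping factors and all large feedback gains
    ((∀ i, S.θ i < S.q i - S.p i + S.b i / S.J i) →
      ∃ κ : ℝ, ∀ k : Fin m → ℝ, (∀ i, κ ≤ k i) → (S.Ww k).IsSPR) ∧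
    -- whenever it is SPR, the gradient law gives boundedness and convergence
    (∀ k : Fin m → ℝ, (S.Ww k).IsSPR →
      ∀ Γ : Matrix (Fin m) (Fin m) ℝ, Γ.PosDef →
      ∀ (n : ℕ) (R : StateSpace n m), R.Realizes (S.Ww k) →
      ∀ σ : LoopSignals n m, σ.Solves G S k R Γ →
        (∃ M : ℝ, ∀ t : ℝ, 0 ≤ t →
          (∀ j, |σ.ex t j| ≤ M) ∧ (∀ i, |σ.err G t i| ≤ M) ∧
            ∀ i l, |σ.XiTilde S k t i l| ≤ M) ∧
        (∀ j, MeasureTheory.IntegrableOn (fun t => σ.ex t j ^ 2) (Set.Ioi 0)) ∧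
        ((∃ M : ℝ, ∀ t : ℝ, 0 ≤ t → |σ.v0 t| ≤ M ∧ |σ.a0 t| ≤ M) →
          Tendsto σ.ex atTop (𝓝 0) ∧
          Tendsto (σ.err G) atTop (𝓝 0) ∧
          ∀ i, Tendsto (fun t => σ.x t i - σ.x0 t) atTop (𝓝 0))) := by
  refine ⟨fun k => ⟨?_, S.relativeDegree_Ww k⟩, S.exists_gain_isSPR, ?_⟩
  · rw [S.Ww_eq_diagonal]
    exact isDiag_diagonal _
  intro k hSPR Γ hΓ n R hR σ h
  obtain ⟨P, hP, hPB, hneg⟩ := hR.exists_kyp_of_isSPR hSPR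
  have hex := h.isBoundedSignal_ex hΓ hP hPB hneg
  have hXi := h.isBoundedSignal_XiTilde hΓ hP hPB hneg
  have herr := h.isBoundedSignal_err hex
  have hint := h.integrableOn_sq_ex hΓ hP hPB hneg
  refine ⟨?_, hint, ?_⟩
  · obtain ⟨M₁, h₁⟩ := IsBoundedSignal.exists_common hex
    obtain ⟨M₂, h₂⟩ := IsBoundedSignal.exists_common herr
    obtain ⟨M₃, h₃⟩ := IsBoundedSignal.exists_common
      (F := fun (il : Fin m × (Fin 3 × Fin m)) t => σ.XiTilde S k t il.1 il.2)
      fun il => hXi il.1 il.2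
    exact ⟨max M₁ (max M₂ M₃), fun t ht => ⟨fun j => (h₁ t ht j).trans (le_max_left _ _),
      fun i => (h₂ t ht i).trans ((le_max_left _ _).trans (le_max_right _ _)),
      fun i l => (h₃ t ht (i, l)).trans ((le_max_right _ _).trans (le_max_right _ _))⟩⟩
  · rintro ⟨M, hM⟩
    have hlim := h.tendsto_ex ⟨M, fun t ht => (hM t ht).1⟩ ⟨M, fun t ht => (hM t ht).2⟩ hex hXi hint
    have herr0 := h.tendsto_err hlim
    exact ⟨hlim, herr0, G.tendsto_sub_of_tendsto_syncError herr0⟩
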